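/- Let $(p_n)_{n\ge 0}$ be non-negative reals with $p_0\neq 0$ and $p_n\neq 0$ for some $n\ge 2$, such that $\varphi(z)=\sum_n p_n z^n$ has radius of convergence $\xi\in(0,\infty]$, and let $\beta,h\in\mathbb R$. For $N\ge 1$ and a sign $\pm$ let $$Z_{N\pm}=\sum_{\tau_s}e^{-H(\tau_s)}\prod_{v\ne r}p_{\sigma_v-1},\qquad H(\tau_s)=-\beta\sum_{(v,w)\in E(\tau)}s_vs_w-h\sum_{v\neq r}s_v,$$ where the sum is over all rooted plane trees $\tau$ with $N$ edges whose root $r$ has degree $1$ and all $s:V(\tau)\to\{\pm1\}$ with $s_r=\pm1$; $\sigma_v$ is the degree of $v$. Put $Z_\pm(g)=\sum_{N\ge 1}Z_{N\pm}g^N$, let $g_0$ be the radius of convergence of $Z_+$, and let $Z_\pm^0=Z_\pm(g_0)=\lim_{g\nearrow g_0}Z_\pm(g)\in[0,\infty]$. Assume the genericity condition $Z_\pm(g_0)<\xi$. Let $a=e^{\beta+h}$, $b=e^{-\beta+h}$ and $$\Phi'(x,y)=\begin{pmatrix}a\varphi'(x)&a^{-1}\varphi'(y)\\ b\varphi'(x)&b^{-1}\varphi'(y)\end{pmatrix}.$$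 Then $0<g_0<\infty$, $g_0$ is also the radius of convergence of $Z_-$, and $(Z_+,Z_-,g)=(Z_+^0,Z_-^0,g_0)$ solves $$Z_+=g\,(a\varphi(Z_+)+a^{-1}\varphi(Z_-)),\quad Z_-=g\,(b\varphi(Z_+)+b^{-1}\varphi(Z_-)),\quad \det(\mathbb 1-g\,\Phi'(Z_+,Z_-))=0.$$ Moreover, let $$\alpha=\frac{g_0a^{-1}\varphi'(Z_-^0)}{1-g_0a\varphi'(Z_+^0)},\qquad K_-=\frac{2}{g_0}\,\frac{\alpha a\,\varphi(Z_+^0)+b^{-1}\varphi(Z_-^0)}{\alpha^3a\,\varphi''(Z_+^0)+b^{-1}\varphi''(Z_-^0)},\qquad K_+=\alpha^2K_- .$$ Then all denominators are nonzero, $\alpha>0$, $K_->0$, and $$\alpha=\frac{1-g_0b^{-1}\varphi'(Z_-^0)}{g_0b\,\varphi'(Z_+^0)}$$ (again with nonzero denominator). Finally, there is $r>0$ such that $Z_\pm$ extend holomorphically from $\{|g|<g_0\}$ to its union with the slit disc $D=\{g\in\mathbb C: |g-g_0|<r,\ g\notin[g_0,\infty)\}$, and on $D$, with the principal branch of the root,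 $$Z_\pm(g)=A_\pm(g)-B_\pm(g)\sqrt{g_0-g},$$ where $A_\pm,B_\pm$ are holomorphic in the full disc $|g-g_0|<r$, $A_\pm(g_0)=Z_\pm^0$ and $B_\pm(g_0)=\sqrt{K_\pm}$; in particular $Z_\pm(g)=Z_\pm^0-\sqrt{K_\pm(g_0-g)}+O(|g_0-g|)$ on $D$. -/

import Mathlib

open scoped ENNReal Topology

noncomputable section

namespace IsingTree

/-- Finite plane (ordered) trees whose vertices carry labels in `α`: a top vertex with its label
and the ordered list of the subtrees attached to its children. -/
inductive PlaneTree (α : Type) : Type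
  | node : α → List (PlaneTree α) → PlaneTree α

namespace PlaneTree

variable {α : Type}

/-- The label of the top vertex. -/
def label : PlaneTree α → α
  | node x _ => x

/-- The number of vertices. -/
def numVertices : PlaneTree α → ℕ
  | node _ ts => 1 + (ts.map fun t => numVertices t).sum

/-- The product over all vertices of `p` evaluated at the number of children of the vertex. -/
def branchWeight (p : ℕ → ℝ) : PlaneTree α → ℝ
  | node _ ts => p ts.length * (ts.map fun t => branchWeight p t).prod

/-- The sum over all edges of the product of the spins at the two ends. -/
def edgeSum : PlaneTree ℤˣ → ℝ
  | node s ts => (ts.map fun t => ((s : ℤ) : ℝ) * ((t.label : ℤ) : ℝ) + edgeSum t).sum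

/-- The sum of the spins over all vertices. -/
def spinSum : PlaneTree ℤˣ → ℝ
  | node s ts => ((s : ℤ) : ℝ) + (ts.map fun t => spinSum t).sum

theorem one_le_numVertices (t : PlaneTree α) : 1 ≤ t.numVertices := by
  cases t with
  | node x ts => rw [numVertices]; omega

theorem length_le_sum (ts : List (PlaneTree α)) :
    ts.length ≤ (ts.map fun t => numVertices t).sum := by
  induction ts with
  | nil => simp
  | cons t ts ih =>
    have := one_le_numVertices t
    simp only [List.length_cons, List.map_cons, List.sum_cons]
    omega

theorem finite_numVertices_le [Finite α] (N : ℕ) :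
    {t : PlaneTree α | t.numVertices ≤ N}.Finite := by
  induction N with
  | zero =>
    refine Set.Finite.subset Set.finite_empty fun t ht => ?_
    have h := one_le_numVertices t
    have h' : t.numVertices ≤ 0 := ht
    omega
  | succ N ih =>
    have : Finite {t : PlaneTree α | t.numVertices ≤ N} := ih
    have hl := List.finite_length_le {t : PlaneTree α | t.numVertices ≤ N} N
    refine Set.Finite.subset
      ((Set.finite_univ.prod hl).image
        fun q : α × List {t : PlaneTree α | t.numVertices ≤ N} =>
          node q.1 (q.2.map Subtype.val)) ?_
    rintro ⟨x, ts⟩ ht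
    have ht' : 1 + (ts.map fun t => numVertices t).sum ≤ N + 1 := by
      have h : (node x ts).numVertices ≤ N + 1 := ht
      rwa [numVertices] at h
    have hmem : ∀ t ∈ ts, t ∈ {t : PlaneTree α | t.numVertices ≤ N} := by
      intro t hts
      have h : t.numVertices ≤ (ts.map fun t => numVertices t).sum :=
        List.le_sum_of_mem (List.mem_map.2 ⟨t, hts, rfl⟩)
      show t.numVertices ≤ N
      omega
    refine ⟨(x, ts.attachWith _ hmem), ⟨trivial, ?_⟩, ?_⟩
    · have := length_le_sum ts
      show (ts.attachWith _ hmem).length ≤ N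
      rw [List.length_attachWith]
      omega
    · show node x ((ts.attachWith _ hmem).map Subtype.val) = node x ts
      rw [List.attachWith_map_subtype_val]

theorem finite_numVertices_eq [Finite α] (N : ℕ) :
    {t : PlaneTree α | t.numVertices = N}.Finite :=
  (finite_numVertices_le N).subset fun _ h => le_of_eq h

end PlaneTree

/-- A finite rooted plane tree with root `r` of order one, decorated with spins: the spin at `r`
and the decorated plane tree spanned by all the other vertices, whose top vertex is the unique
neighbour of `r`. -/
structure DecoratedTree : Type where
  rootSpin : ℤˣ
  branch : PlaneTree ℤˣ

namespace DecoratedTree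

/-- The number of edges: sending a vertex other than `r` to the edge towards the root is a
bijection from these vertices onto the edges. -/
def size (t : DecoratedTree) : ℕ := t.branch.numVertices

/-- The energy `-β ∑_{edges} s_v s_w - h ∑_{v ≠ r} s_v`. -/
def hamiltonian (β h : ℝ) (t : DecoratedTree) : ℝ :=
  -β * (((t.rootSpin : ℤ) : ℝ) * ((t.branch.label : ℤ) : ℝ) + t.branch.edgeSum)
    - h * t.branch.spinSum

/-- The weight `∏_{v ≠ r} p_{σ_v - 1}`, where `σ_v` is the degree of `v`. -/
def weight (p : ℕ → ℝ) (t : DecoratedTree) : ℝ := t.branch.branchWeight p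

theorem finite_size_rootSpin (N : ℕ) (ε : ℤˣ) :
    {t : DecoratedTree | t.size = N ∧ t.rootSpin = ε}.Finite := by
  refine ((PlaneTree.finite_numVertices_eq (α := ℤˣ) N).image fun b => ⟨ε, b⟩).subset ?_
  rintro ⟨e, b⟩ ⟨h1, h2⟩
  exact ⟨b, h1, by cases h2; rfl⟩

end DecoratedTree

/-- The partition function of the decorated trees of size `N` with spin `ε` at the root. -/
def partitionFn (p : ℕ → ℝ) (β h : ℝ) (ε : ℤˣ) (N : ℕ) : ℝ :=
  ∑ t ∈ (DecoratedTree.finite_size_rootSpin N ε).toFinset,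
    Real.exp (-t.hamiltonian β h) * t.weight p

/-- The generating function `Z_ε(g) = ∑ Z_{N,ε} g^N` of a complex variable. -/
def genFn (p : ℕ → ℝ) (β h : ℝ) (ε : ℤˣ) (g : ℂ) : ℂ :=
  ∑' N, (partitionFn p β h ε N : ℂ) * g ^ N

/-- The same series at a nonnegative argument, with values in `[0, ∞]`. -/
def genFnENN (p : ℕ → ℝ) (β h : ℝ) (ε : ℤˣ) (g : ℝ≥0∞) : ℝ≥0∞ :=
  ∑' N, ENNReal.ofReal (partitionFn p β h ε N) * g ^ N

/-- The radius of convergence of the power series with coefficients `c`. -/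
def convRadius (c : ℕ → ℝ) : ℝ≥0∞ := (FormalMultilinearSeries.ofScalars ℝ c).radius

/-- The generating function `φ` of the branching weights. -/
def phi (p : ℕ → ℝ) (x : ℝ) : ℝ := ∑' n, p n * x ^ n

/-- The radius of convergence of `Z_+`, in `[0, ∞]`. -/
def critRadius (p : ℕ → ℝ) (β h : ℝ) : ℝ≥0∞ := convRadius (partitionFn p β h 1)

/-- The critical value `g₀` as a real number. -/
def g0 (p : ℕ → ℝ) (β h : ℝ) : ℝ := (critRadius p β h).toReal

/-- The limit of `Z_ε(g)` as `g` increases to `g₀`, in `[0, ∞]`. -/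
def critValue (p : ℕ → ℝ) (β h : ℝ) (ε : ℤˣ) : ℝ≥0∞ :=
  Function.leftLim (genFnENN p β h ε) (critRadius p β h)

/-- The value `Z_ε^0 = Z_ε(g₀)` as a real number. -/
def Z0 (p : ℕ → ℝ) (β h : ℝ) (ε : ℤˣ) : ℝ := (critValue p β h ε).toReal

/-- The genericity condition `Z_±(g₀) < ξ`, where `ξ` is the radius of convergence of `φ`. -/
def IsGeneric (p : ℕ → ℝ) (β h : ℝ) : Prop :=
  critValue p β h 1 < convRadius p ∧ critValue p β h (-1) < convRadius p

/-- `a = e^{β + h}`. -/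
def a (β h : ℝ) : ℝ := Real.exp (β + h)

/-- `b = e^{-β + h}`. -/
def b (β h : ℝ) : ℝ := Real.exp (-β + h)

/-- The Jacobian matrix `Φ'(x, y)` of
`Φ(x, y) = (a φ(x) + a⁻¹ φ(y), b φ(x) + b⁻¹ φ(y))`. -/
def PhiPrime (p : ℕ → ℝ) (β h x y : ℝ) : Matrix (Fin 2) (Fin 2) ℝ :=
  !![a β h * deriv (phi p) x, (a β h)⁻¹ * deriv (phi p) y;
     b β h * deriv (phi p) x, (b β h)⁻¹ * deriv (phi p) y]

/-- The triple `(x, y, g)` solves `x = g (a φ(x) + a⁻¹ φ(y))`, `y = g (b φ(x) + b⁻¹ φ(y))`,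
`det (1 - g Φ'(x, y)) = 0`. -/
def IsCriticalSolution (p : ℕ → ℝ) (β h x y g : ℝ) : Prop :=
  x = g * (a β h * phi p x + (a β h)⁻¹ * phi p y) ∧
  y = g * (b β h * phi p x + (b β h)⁻¹ * phi p y) ∧
  (1 - g • PhiPrime p β h x y).det = 0

/-- The constant `α`. -/
def alpha (p : ℕ → ℝ) (β h : ℝ) : ℝ :=
  g0 p β h * (a β h)⁻¹ * deriv (phi p) (Z0 p β h (-1)) /
    (1 - g0 p β h * a β h * deriv (phi p) (Z0 p β h 1))

/-- The constant `K_-`. -/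
def Kminus (p : ℕ → ℝ) (β h : ℝ) : ℝ :=
  2 / g0 p β h *
    ((alpha p β h * a β h * phi p (Z0 p β h 1) + (b β h)⁻¹ * phi p (Z0 p β h (-1))) /
      (alpha p β h ^ 3 * a β h * deriv (deriv (phi p)) (Z0 p β h 1) +
        (b β h)⁻¹ * deriv (deriv (phi p)) (Z0 p β h (-1))))

/-- The constant `K_+ = α² K_-`. -/
def Kplus (p : ℕ → ℝ) (β h : ℝ) : ℝ := alpha p β h ^ 2 * Kminus p β h

/-- The disc of radius `r` around `x`, slit along the ray from `x` to the right
(`Complex.arg 0 = 0`, so the centre is removed too). -/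
def slitDisc (x r : ℝ) : Set ℂ := {g : ℂ | ‖g - (x : ℂ)‖ < r ∧ Complex.arg (g - (x : ℂ)) ≠ 0}

/-- The function `Z`, given on the disc `|g| < x`, continues holomorphically to the slit disc
of radius `r` around `x`, where it equals `A(g) - B(g) √(x - g)` (principal branch) with `A`, `B`
holomorphic in the full disc around `x`, `A(x) = z`, `B(x) = √K`; and it is
`z - √(K (x - g)) + O(|x - g|)` on the slit disc. -/
def HasSqrtSingularity (Z : ℂ → ℂ) (x z K r : ℝ) : Prop :=
  ∃ Y : ℂ → ℂ,
    DifferentiableOn ℂ Y (Metric.ball 0 x ∪ slitDisc x r) ∧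
    (∀ g ∈ Metric.ball (0 : ℂ) x, Y g = Z g) ∧
    (∃ A B : ℂ → ℂ,
      DifferentiableOn ℂ A (Metric.ball (x : ℂ) r) ∧
      DifferentiableOn ℂ B (Metric.ball (x : ℂ) r) ∧
      A x = (z : ℂ) ∧ B x = (Real.sqrt K : ℂ) ∧
      ∀ g ∈ slitDisc x r, Y g = A g - B g * ((x : ℂ) - g) ^ (1 / 2 : ℂ)) ∧
    ∃ C : ℝ, ∀ g ∈ slitDisc x r,
      ‖Y g - ((z : ℂ) - ((K : ℂ) * ((x : ℂ) - g)) ^ (1 / 2 : ℂ))‖ ≤ C * ‖(x : ℂ) - g‖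

end IsingTree

end

noncomputable section

namespace IsingTree

/-! Cutting a tree at the neighbour of the root turns Z = (Z_+, Z_-) into a solution of Z = g Φ(Z)
in [0, ∞], and induction on the number of vertices shows that Z is the least supersolution
(`genFnENN_eq`, `genFnENN_le`). A constant supersolution at small g gives g₀ > 0. A nonzero
coefficient of degree at least 2 makes the equation unsolvable for large g, so g₀ < ∞. All matrix
entries are positive, so Z_+ and Z_- are finite at the same g > 0.

Genericity puts Z⁰ strictly inside the domain of analyticity of φ. For g < g₀, convexity of φ makes
v = Z⁰ - Z(g) a positive vector with g Φ'(Z(g)) v < v, whence det(1 - g Φ') ≥ 0 (`subcritical`), and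
this persists at g₀. If the determinant at g₀ were positive, some positive v would satisfy g₀ Φ'(Z⁰)
v < v. Then Z⁰ + δ v would be a supersolution for some g > g₀, against the definition of g₀
(`not_exists_contracted_vector`). So the determinant vanishes.

Near the critical point, eliminating g leaves an analytic curve Z_+ = X(Z_-) with X' = α. Pairing
the system with the left null vector of 1 - g₀ Φ' cancels the linear terms and leaves g₀ - g =
k(Z_-) (Z_- - Z_-⁰)², where k(Z_-⁰) = 1/K_-. An analytic square root of the right side is a local
coordinate. Its inverse ψ gives Z_- = ψ(√(g₀ - g)) and Z_+ = X(ψ(√(g₀ - g))) for real g just below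
g₀ (`exists_local_uniformization`). The even and odd parts of these analytic functions supply A and
B, and the identity theorem carries the formula from the real segment to the slit disc
(`exists_hasSqrtSingularity`). -/

/-- The power series with coefficients `c`, as a function with values in `[0, ∞]`. -/
def phiENN (c : ℕ → ℝ) (x : ℝ≥0∞) : ℝ≥0∞ := ∑' n, ENNReal.ofReal (c n) * x ^ n

theorem phiENN_mono (c : ℕ → ℝ) : Monotone (phiENN c) := fun _ _ h =>
  ENNReal.tsum_le_tsum fun n => mul_le_mul_right (pow_le_pow_left' h n) _

/-- The multiplicatively weighted sum over all lists is a geometric-type series in the total weight. -/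
theorem tsum_list_prod_map {X : Type} (f : X → ℝ≥0∞) (c : ℕ → ℝ≥0∞) :
    ∑' l : List X, c l.length * (l.map f).prod = ∑' n, c n * (∑' x, f x) ^ n := by
  -- Lists are grouped by length: those of length n contribute the n-th power of the total weight.
  have key : ∀ n, ∑' v : List.Vector X n, (v.toList.map f).prod = (∑' x, f x) ^ n := by
    intro n
    induction n with
    | zero =>
      rw [tsum_eq_single List.Vector.nil (fun v hv => absurd (Subsingleton.elim v _) hv)]
      simp
    | succ n ih =>
      let e : X × List.Vector X n ≃ List.Vector X (n + 1) :=
        { toFun := fun q => q.1 ::ᵥ q.2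
          invFun := fun v => (v.head, v.tail)
          left_inv := fun q => by simp
          right_inv := fun v => by simp }
      rw [← e.tsum_eq, ENNReal.tsum_prod', pow_succ', ← ENNReal.tsum_mul_right]
      refine tsum_congr fun x => ?_
      rw [← ih, ← ENNReal.tsum_mul_left]
      refine tsum_congr fun v => ?_
      simp [e]
  rw [← (Equiv.sigmaFiberEquiv (List.length (α := X))).tsum_eq, ENNReal.tsum_sigma']
  refine tsum_congr fun n => ?_
  rw [← key, ← ENNReal.tsum_mul_left]
  refine tsum_congr fun v => ?_
  obtain ⟨l, rfl⟩ := v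
  rfl

/-- The Boltzmann factor of an edge joining a vertex with spin `ε` to a child with spin `s`,
including the magnetic factor of the child. -/
def edgeFactor (β h : ℝ) (ε s : ℤˣ) : ℝ :=
  Real.exp (β * ((ε : ℤ) : ℝ) * ((s : ℤ) : ℝ) + h * ((s : ℤ) : ℝ))

theorem edgeFactor_pos (β h : ℝ) (ε s : ℤˣ) : 0 < edgeFactor β h ε s := Real.exp_pos _

theorem edgeFactor_one_one (β h : ℝ) : edgeFactor β h 1 1 = a β h := by
  simp [edgeFactor, a]

theorem edgeFactor_one_neg (β h : ℝ) : edgeFactor β h 1 (-1) = (a β h)⁻¹ := by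
  rw [a, ← Real.exp_neg, edgeFactor]; congr 1; push_cast; ring

theorem edgeFactor_neg_one (β h : ℝ) : edgeFactor β h (-1) 1 = b β h := by
  simp [edgeFactor, b]

theorem edgeFactor_neg_neg (β h : ℝ) : edgeFactor β h (-1) (-1) = (b β h)⁻¹ := by
  rw [b, ← Real.exp_neg, edgeFactor]; congr 1; push_cast; ring

/-! ### Factorisation of tree weights at the top vertex -/

namespace PlaneTree

/-- The weight of a tree hanging below a vertex with spin `ε`. -/
def boltzmann (p : ℕ → ℝ) (β h : ℝ) (ε : ℤˣ) (t : PlaneTree ℤˣ) : ℝ :=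
  Real.exp (β * (((ε : ℤ) : ℝ) * ((t.label : ℤ) : ℝ) + t.edgeSum) + h * t.spinSum) *
    t.branchWeight p

/-- Each vertex is charged with its own field term and with the edge to its parent, so the weight
splits over the subtrees, each of which sees only the spin `s` above it. -/
theorem boltzmann_node (p : ℕ → ℝ) (β h : ℝ) (ε s : ℤˣ) (ts : List (PlaneTree ℤˣ)) :
    boltzmann p β h ε (node s ts) =
      edgeFactor β h ε s * (p ts.length * (ts.map (boltzmann p β h s)).prod) := by
  have hl : (ts.map (boltzmann p β h s)).prod =
      Real.exp (β * (ts.map fun t => ((s : ℤ) : ℝ) * ((t.label : ℤ) : ℝ) + edgeSum t).sum +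
        h * (ts.map fun t => spinSum t).sum) * (ts.map fun t => branchWeight p t).prod := by
    induction ts with
    | nil => simp
    | cons t ts ih =>
      simp only [List.map_cons, List.prod_cons, List.sum_cons, ih, boltzmann]
      rw [show ∀ x y z w : ℝ, (x * y) * (z * w) = (x * z) * (y * w) by intros; ring,
        ← Real.exp_add]
      congr 2
      ring
  rw [hl, boltzmann, edgeFactor, label, edgeSum, spinSum, branchWeight,
    show ∀ x y z w : ℝ, x * (y * (z * w)) = (x * z) * (y * w) by intros; ring, ← Real.exp_add]
  congr 2
  ring

theorem branchWeight_nonneg {p : ℕ → ℝ} (hp : ∀ n, 0 ≤ p n) {α : Type} :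
    ∀ t : PlaneTree α, 0 ≤ t.branchWeight p
  | node x ts => by
    rw [branchWeight]
    refine mul_nonneg (hp _) (List.prod_nonneg ?_)
    intro y hy
    obtain ⟨t, ht, rfl⟩ := List.mem_map.1 hy
    exact branchWeight_nonneg hp t

theorem boltzmann_nonneg {p : ℕ → ℝ} (hp : ∀ n, 0 ≤ p n) (β h : ℝ) (ε : ℤˣ) (t : PlaneTree ℤˣ) :
    0 ≤ boltzmann p β h ε t :=
  mul_nonneg (Real.exp_pos _).le (branchWeight_nonneg hp t)

/-- The contribution of a tree to the generating function. -/
def term (p : ℕ → ℝ) (β h : ℝ) (g : ℝ≥0∞) (ε : ℤˣ) (t : PlaneTree ℤˣ) : ℝ≥0∞ :=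
  ENNReal.ofReal (boltzmann p β h ε t) * g ^ t.numVertices

theorem term_node {p : ℕ → ℝ} (hp : ∀ n, 0 ≤ p n) (β h : ℝ) (g : ℝ≥0∞) (ε s : ℤˣ)
    (ts : List (PlaneTree ℤˣ)) :
    term p β h g ε (node s ts) = g * ENNReal.ofReal (edgeFactor β h ε s) *
      (ENNReal.ofReal (p ts.length) * (ts.map (term p β h g s)).prod) := by
  have hl : (ts.map (term p β h g s)).prod =
      ENNReal.ofReal (ts.map (boltzmann p β h s)).prod *
        g ^ (ts.map fun t => numVertices t).sum := by
    induction ts with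
    | nil => simp
    | cons t ts ih =>
      simp only [List.map_cons, List.prod_cons, List.sum_cons, ih, term]
      rw [ENNReal.ofReal_mul (boltzmann_nonneg hp _ _ _ _), pow_add]
      ring
  rw [hl, term, boltzmann_node, numVertices, ENNReal.ofReal_mul (edgeFactor_pos _ _ _ _).le,
    ENNReal.ofReal_mul (hp _), pow_add, pow_one]
  ring

/-- A tree is its top label together with the list of its subtrees. -/
def nodeEquiv (α : Type) : α × List (PlaneTree α) ≃ PlaneTree α where
  toFun q := node q.1 q.2
  invFun | node x ts => (x, ts)
  left_inv _ := rfl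
  right_inv t := by cases t; rfl

theorem tsum_eq_nodes (f : PlaneTree ℤˣ → ℝ≥0∞) :
    ∑' t, f t = (∑' ts, f (node 1 ts)) + ∑' ts, f (node (-1) ts) := by
  rw [← (nodeEquiv ℤˣ).tsum_eq, ENNReal.tsum_prod', tsum_fintype]
  simp only [nodeEquiv, Equiv.coe_fn_mk]
  rw [show (Finset.univ : Finset ℤˣ) = {1, -1} from rfl, Finset.sum_pair (by decide)]

theorem tsum_term_node {p : ℕ → ℝ} (hp : ∀ n, 0 ≤ p n) (β h : ℝ) (g : ℝ≥0∞) (ε s : ℤˣ) :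
    ∑' ts, term p β h g ε (node s ts) =
      g * ENNReal.ofReal (edgeFactor β h ε s) * phiENN p (∑' t, term p β h g s t) := by
  simp only [term_node hp, ENNReal.tsum_mul_left]
  rw [tsum_list_prod_map (term p β h g s) fun n => ENNReal.ofReal (p n)]
  rfl

/-- The contributions of the trees with at most `N` vertices. -/
def truncTerm (p : ℕ → ℝ) (β h : ℝ) (g : ℝ≥0∞) (N : ℕ) (ε : ℤˣ) (t : PlaneTree ℤˣ) : ℝ≥0∞ :=
  if t.numVertices ≤ N then term p β h g ε t else 0

/-- The top vertex uses up one of the `N + 1` vertices, so every subtree has at most `N`. Only an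
inequality holds, since subtrees of size at most `N` may together exceed the bound. -/
theorem truncTerm_succ_node_le {p : ℕ → ℝ} (hp : ∀ n, 0 ≤ p n) (β h : ℝ) (g : ℝ≥0∞) (N : ℕ)
    (ε s : ℤˣ) (ts : List (PlaneTree ℤˣ)) :
    truncTerm p β h g (N + 1) ε (node s ts) ≤ g * ENNReal.ofReal (edgeFactor β h ε s) *
      (ENNReal.ofReal (p ts.length) * (ts.map (truncTerm p β h g N s)).prod) := by
  rw [truncTerm]
  split_ifs with hN
  · rw [term_node hp]
    refine le_of_eq ?_
    congr 3
    refine List.map_congr_left fun t ht => ?_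
    rw [truncTerm, if_pos]
    have h1 : t.numVertices ≤ (ts.map fun t => numVertices t).sum :=
      List.le_sum_of_mem (List.mem_map.2 ⟨t, ht, rfl⟩)
    rw [numVertices] at hN
    omega
  · exact zero_le

/-- Truncating by the number of vertices is like iterating the recursion from 0: monotonicity of φ
keeps every truncated sum below the supersolution, and the full sum is their supremum. -/
theorem tsum_term_le {p : ℕ → ℝ} (hp : ∀ n, 0 ≤ p n) (β h : ℝ) (g : ℝ≥0∞) (x : ℤˣ → ℝ≥0∞)
    (hx : ∀ ε, g * ENNReal.ofReal (edgeFactor β h ε 1) * phiENN p (x 1) +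
      g * ENNReal.ofReal (edgeFactor β h ε (-1)) * phiENN p (x (-1)) ≤ x ε) (ε : ℤˣ) :
    ∑' t, term p β h g ε t ≤ x ε := by
  have key : ∀ N ε, ∑' t, truncTerm p β h g N ε t ≤ x ε := by
    intro N
    induction N with
    | zero =>
      intro ε
      have : ∀ t, truncTerm p β h g 0 ε t = 0 := fun t => by
        rw [truncTerm, if_neg]
        have := one_le_numVertices t
        omega
      simp [this]
    | succ N ih =>
      intro ε
      have hs : ∀ s, ∑' ts, truncTerm p β h g (N + 1) ε (node s ts) ≤
          g * ENNReal.ofReal (edgeFactor β h ε s) * phiENN p (x s) := by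
        intro s
        refine (ENNReal.tsum_le_tsum fun ts =>
          truncTerm_succ_node_le hp β h g N ε s ts).trans ?_
        rw [ENNReal.tsum_mul_left,
          tsum_list_prod_map (truncTerm p β h g N s) fun n => ENNReal.ofReal (p n)]
        exact mul_le_mul_right (phiENN_mono p (ih s)) _
      rw [tsum_eq_nodes]
      exact (add_le_add (hs 1) (hs (-1))).trans (hx ε)
  rw [ENNReal.tsum_eq_iSup_sum]
  refine iSup_le fun F => ?_
  -- A finite set of trees is not affected by truncation at its largest vertex count.
  refine le_trans ?_ ((ENNReal.sum_le_tsum F).trans (key (F.sup numVertices) ε))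
  refine Finset.sum_le_sum fun t ht => ?_
  rw [truncTerm, if_pos (Finset.le_sup ht)]

end PlaneTree

/-! ### The functional equation and the minimality of its solution -/

open PlaneTree

theorem partitionFn_nonneg {p : ℕ → ℝ} (hp : ∀ n, 0 ≤ p n) (β h : ℝ) (ε : ℤˣ) (N : ℕ) :
    0 ≤ partitionFn p β h ε N :=
  Finset.sum_nonneg fun _ _ => mul_nonneg (Real.exp_pos _).le (branchWeight_nonneg hp _)

theorem ofReal_partitionFn {p : ℕ → ℝ} (hp : ∀ n, 0 ≤ p n) (β h : ℝ) (ε : ℤˣ) (N : ℕ) :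
    ENNReal.ofReal (partitionFn p β h ε N) =
      ∑' t : PlaneTree ℤˣ, if t.numVertices = N then ENNReal.ofReal (boltzmann p β h ε t) else 0 := by
  have hw : ∀ t : DecoratedTree, Real.exp (-t.hamiltonian β h) * t.weight p =
      boltzmann p β h t.rootSpin t.branch := fun t => by
    rw [boltzmann, DecoratedTree.weight, DecoratedTree.hamiltonian]
    congr 2
    ring
  rw [partitionFn, ENNReal.ofReal_sum_of_nonneg fun t _ =>
    show 0 ≤ Real.exp (-t.hamiltonian β h) * t.weight p from
      mul_nonneg (Real.exp_pos _).le (branchWeight_nonneg hp _)]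
  rw [tsum_eq_sum (s := (finite_numVertices_eq (α := ℤˣ) N).toFinset)]
  · refine Finset.sum_nbij' (fun t => t.branch) (fun b => ⟨ε, b⟩) ?_ ?_ ?_ ?_ ?_
    · intro t ht
      simp only [Set.Finite.mem_toFinset, Set.mem_ofPred_eq] at ht ⊢
      exact ht.1
    · intro b hb
      simp only [Set.Finite.mem_toFinset, Set.mem_ofPred_eq] at hb ⊢
      exact ⟨hb, trivial⟩
    · rintro ⟨s, b⟩ ht
      simp only [Set.Finite.mem_toFinset, Set.mem_ofPred_eq] at ht ⊢
      rw [ht.2]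
    · intro b _
      rfl
    · intro t ht
      simp only [Set.Finite.mem_toFinset, Set.mem_ofPred_eq] at ht
      rw [hw, ht.2, if_pos]
      exact ht.1
  · intro t ht
    simp only [Set.Finite.mem_toFinset, Set.mem_ofPred_eq] at ht
    rw [if_neg ht]

theorem genFnENN_eq_phiENN (p : ℕ → ℝ) (β h : ℝ) (ε : ℤˣ) :
    genFnENN p β h ε = phiENN (partitionFn p β h ε) := rfl

theorem genFnENN_eq_tsum {p : ℕ → ℝ} (hp : ∀ n, 0 ≤ p n) (β h : ℝ) (ε : ℤˣ) (g : ℝ≥0∞) :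
    genFnENN p β h ε g = ∑' t, term p β h g ε t := by
  simp only [genFnENN, ofReal_partitionFn hp, ← ENNReal.tsum_mul_right]
  rw [ENNReal.tsum_comm]
  refine tsum_congr fun t => ?_
  rw [tsum_eq_single t.numVertices]
  · simp [term]
  · intro N hN
    rw [if_neg (Ne.symm hN), zero_mul]

/-- The recursion for the generating functions, obtained by removing the root. -/
theorem genFnENN_eq {p : ℕ → ℝ} (hp : ∀ n, 0 ≤ p n) (β h : ℝ) (ε : ℤˣ) (g : ℝ≥0∞) :
    genFnENN p β h ε g =
      g * ENNReal.ofReal (edgeFactor β h ε 1) * phiENN p (genFnENN p β h 1 g) +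
        g * ENNReal.ofReal (edgeFactor β h ε (-1)) * phiENN p (genFnENN p β h (-1) g) := by
  simp only [genFnENN_eq_tsum hp]
  rw [tsum_eq_nodes, tsum_term_node hp, tsum_term_node hp]

/-- The generating functions are bounded by every supersolution of the recursion. -/
theorem genFnENN_le {p : ℕ → ℝ} (hp : ∀ n, 0 ≤ p n) (β h : ℝ) (g : ℝ≥0∞) (x : ℤˣ → ℝ≥0∞)
    (hx : ∀ ε, g * ENNReal.ofReal (edgeFactor β h ε 1) * phiENN p (x 1) +
      g * ENNReal.ofReal (edgeFactor β h ε (-1)) * phiENN p (x (-1)) ≤ x ε) (ε : ℤˣ) :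
    genFnENN p β h ε g ≤ x ε := by
  rw [genFnENN_eq_tsum hp]
  exact tsum_term_le hp β h g x hx ε

/-! ### Power series with nonnegative coefficients -/

section PowerSeries

variable {c : ℕ → ℝ}

/-- The power series with coefficients `c` at a complex argument. -/
def phiC (c : ℕ → ℝ) (z : ℂ) : ℂ := ∑' n, (c n : ℂ) * z ^ n

/-- The coefficients of the derivative of a power series. -/
def derivCoeff (c : ℕ → ℝ) (n : ℕ) : ℝ := (n + 1) * c (n + 1)

theorem derivCoeff_nonneg (hc : ∀ n, 0 ≤ c n) (n : ℕ) : 0 ≤ derivCoeff c n :=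
  mul_nonneg (by positivity) (hc _)

theorem summable_of_lt_convRadius (hc : ∀ n, 0 ≤ c n) {x : ℝ} (hx : 0 ≤ x)
    (h : ENNReal.ofReal x < convRadius c) : Summable fun n => c n * x ^ n := by
  have := (FormalMultilinearSeries.ofScalars ℝ c).summable_norm_mul_pow (r := x.toNNReal) h
  simpa [FormalMultilinearSeries.ofScalars_norm, abs_of_nonneg (hc _), Real.coe_toNNReal x hx]
    using this

theorem le_convRadius_of_summable (hc : ∀ n, 0 ≤ c n) {x : ℝ} (hx : 0 ≤ x)
    (h : Summable fun n => c n * x ^ n) : ENNReal.ofReal x ≤ convRadius c := by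
  refine (FormalMultilinearSeries.ofScalars ℝ c).le_radius_of_summable_norm (r := x.toNNReal) ?_
  simpa [FormalMultilinearSeries.ofScalars_norm, abs_of_nonneg (hc _), Real.coe_toNNReal x hx]
    using h

theorem phiENN_ofReal (hc : ∀ n, 0 ≤ c n) {x : ℝ} (hx : 0 ≤ x)
    (h : Summable fun n => c n * x ^ n) : phiENN c (ENNReal.ofReal x) = ENNReal.ofReal (phi c x) := by
  rw [phi, ENNReal.ofReal_tsum_of_nonneg (fun n => mul_nonneg (hc n) (pow_nonneg hx n)) h]
  refine tsum_congr fun n => ?_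
  rw [ENNReal.ofReal_mul (hc n), ENNReal.ofReal_pow hx]

theorem summable_of_phiENN_ne_top (hc : ∀ n, 0 ≤ c n) {x : ℝ} (hx : 0 ≤ x)
    (h : phiENN c (ENNReal.ofReal x) ≠ ⊤) : Summable fun n => c n * x ^ n := by
  have := ENNReal.summable_toReal h
  refine this.congr fun n => ?_
  rw [ENNReal.toReal_mul, ENNReal.toReal_pow, ENNReal.toReal_ofReal (hc n),
    ENNReal.toReal_ofReal hx]

theorem phi_nonneg (hc : ∀ n, 0 ≤ c n) {x : ℝ} (hx : 0 ≤ x) : 0 ≤ phi c x :=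
  tsum_nonneg fun n => mul_nonneg (hc n) (pow_nonneg hx n)

theorem term_le_phi (hc : ∀ n, 0 ≤ c n) {x : ℝ} (hx : 0 ≤ x)
    (h : ENNReal.ofReal x < convRadius c) (n : ℕ) : c n * x ^ n ≤ phi c x :=
  (summable_of_lt_convRadius hc hx h).le_tsum n fun m _ => mul_nonneg (hc m) (pow_nonneg hx m)

theorem phi_pos (hc : ∀ n, 0 ≤ c n) {x : ℝ} (hx : 0 < x)
    (h : ENNReal.ofReal x < convRadius c) {n : ℕ} (hn : c n ≠ 0) : 0 < phi c x :=
  lt_of_lt_of_le (mul_pos ((hc n).lt_of_ne' hn) (pow_pos hx n)) (term_le_phi hc hx.le h n)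

theorem phi_mono (hc : ∀ n, 0 ≤ c n) {x y : ℝ} (hx : 0 ≤ x) (hxy : x ≤ y)
    (h : ENNReal.ofReal y < convRadius c) : phi c x ≤ phi c y :=
  Summable.tsum_le_tsum
    (fun n => mul_le_mul_of_nonneg_left (pow_le_pow_left₀ hx hxy n) (hc n))
    (summable_of_lt_convRadius hc hx ((ENNReal.ofReal_le_ofReal hxy).trans_lt h))
    (summable_of_lt_convRadius hc (hx.trans hxy) h)

theorem phiC_ofReal (c : ℕ → ℝ) (x : ℝ) : phiC c x = (phi c x : ℂ) := by
  simp [phiC, phi, Complex.ofReal_tsum]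

theorem exists_gt_of_lt_convRadius {x : ℝ} (h : ENNReal.ofReal x < convRadius c) :
    ∃ y, x < y ∧ 0 < y ∧ ENNReal.ofReal y < convRadius c := by
  obtain ⟨y, hy1, hy2⟩ := ENNReal.lt_iff_exists_nnreal_btwn.1 h
  have hxy : x < y := by
    by_contra! hyx
    exact absurd hy1 (not_lt.2 (by
      rw [← ENNReal.ofReal_coe_nnreal]; exact ENNReal.ofReal_le_ofReal hyx))
  refine ⟨y, hxy, ?_, by rwa [ENNReal.ofReal_coe_nnreal]⟩
  have : (0 : ℝ≥0∞) < y := (zero_le).trans_lt hy1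
  exact_mod_cast this

/-- On a slightly larger disc of radius y the terms are dominated by `c n * y ^ n`, so the series
may be differentiated term by term. -/
theorem differentiableAt_phiC_and_hasSum_deriv (hc : ∀ n, 0 ≤ c n) {z : ℂ} (h : ENNReal.ofReal ‖z‖ < convRadius c) :
    DifferentiableAt ℂ (phiC c) z ∧
      HasSum (fun n => (derivCoeff c n : ℂ) * z ^ n) (deriv (phiC c) z) := by
  obtain ⟨y, hzy, hy0, hy⟩ := exists_gt_of_lt_convRadius h
  have hs := summable_of_lt_convRadius hc hy0.le hy
  have hz : z ∈ Metric.ball (0 : ℂ) y := by simpa using hzy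
  have hd : ∀ n, DifferentiableOn ℂ (fun w : ℂ => (c n : ℂ) * w ^ n) (Metric.ball 0 y) := fun n =>
    ((differentiable_id.pow n).const_mul _).differentiableOn
  have hb : ∀ n, ∀ w ∈ Metric.ball (0 : ℂ) y, ‖(c n : ℂ) * w ^ n‖ ≤ c n * y ^ n := by
    intro n w hw
    rw [norm_mul, norm_pow, Complex.norm_real, Real.norm_of_nonneg (hc n)]
    exact mul_le_mul_of_nonneg_left
      (pow_le_pow_left₀ (norm_nonneg _) (mem_ball_zero_iff.1 hw).le n) (hc n)
  refine ⟨(Complex.differentiableOn_tsum_of_summable_norm hs hd Metric.isOpen_ball hb).differentiableAt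
    (Metric.isOpen_ball.mem_nhds hz), ?_⟩
  have h1 := Complex.hasSum_deriv_of_summable_norm hs hd Metric.isOpen_ball hb hz
  -- The constant term has derivative zero; dropping it produces the index shift in `derivCoeff`.
  have h2 := (hasSum_nat_add_iff' 1).2 h1
  simp only [Finset.range_one, Finset.sum_singleton, pow_zero, deriv_const, sub_zero] at h2
  refine h2.congr_fun fun n => ?_
  simp [derivCoeff]
  ring

theorem summable_derivCoeff (hc : ∀ n, 0 ≤ c n) {x : ℝ} (hx : 0 ≤ x)
    (h : ENNReal.ofReal x < convRadius c) : Summable fun n => derivCoeff c n * x ^ n := by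
  have h' : ENNReal.ofReal ‖(x : ℂ)‖ < convRadius c := by
    rwa [Complex.norm_real, Real.norm_of_nonneg hx]
  have := (differentiableAt_phiC_and_hasSum_deriv hc h').2.summable
  exact_mod_cast this

theorem convRadius_le_derivCoeff (hc : ∀ n, 0 ≤ c n) :
    convRadius c ≤ convRadius (derivCoeff c) := by
  refine le_of_forall_lt fun x hx => ?_
  obtain ⟨y, hy1, hy2⟩ := ENNReal.lt_iff_exists_nnreal_btwn.1 hx
  refine hy1.trans_le ?_
  rw [← ENNReal.ofReal_coe_nnreal] at hy2 ⊢
  exact le_convRadius_of_summable (derivCoeff_nonneg hc) y.2 (summable_derivCoeff hc y.2 hy2)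

theorem hasDerivAt_phiC (hc : ∀ n, 0 ≤ c n) {z : ℂ} (h : ENNReal.ofReal ‖z‖ < convRadius c) :
    HasDerivAt (phiC c) (phiC (derivCoeff c) z) z := by
  have := differentiableAt_phiC_and_hasSum_deriv hc h
  rw [show phiC (derivCoeff c) z = deriv (phiC c) z from this.2.tsum_eq]
  exact this.1.hasDerivAt

theorem differentiableOn_phiC (hc : ∀ n, 0 ≤ c n) {x : ℝ} (h : ENNReal.ofReal x ≤ convRadius c) :
    DifferentiableOn ℂ (phiC c) (Metric.ball 0 x) := by
  intro z hz
  have hz' : ‖z‖ < x := mem_ball_zero_iff.1 hz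
  exact (hasDerivAt_phiC hc (((ENNReal.ofReal_lt_ofReal_iff
    ((norm_nonneg z).trans_lt hz')).2 hz').trans_le h)).differentiableAt.differentiableWithinAt

theorem analyticAt_phiC (hc : ∀ n, 0 ≤ c n) {z : ℂ} (h : ENNReal.ofReal ‖z‖ < convRadius c) :
    AnalyticAt ℂ (phiC c) z := by
  obtain ⟨y, hzy, -, hy⟩ := exists_gt_of_lt_convRadius h
  exact (differentiableOn_phiC hc hy.le).analyticAt
    (Metric.isOpen_ball.mem_nhds (by simpa using hzy))

theorem hasDerivAt_phi (hc : ∀ n, 0 ≤ c n) {x : ℝ} (hx : 0 ≤ x)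
    (h : ENNReal.ofReal x < convRadius c) : HasDerivAt (phi c) (phi (derivCoeff c) x) x := by
  have h' : ENNReal.ofReal ‖(x : ℂ)‖ < convRadius c := by
    rwa [Complex.norm_real, Real.norm_of_nonneg hx]
  have := (hasDerivAt_phiC hc h').real_of_complex
  simpa [phiC_ofReal] using this

theorem deriv_phi (hc : ∀ n, 0 ≤ c n) {x : ℝ} (hx : 0 ≤ x)
    (h : ENNReal.ofReal x < convRadius c) : deriv (phi c) x = phi (derivCoeff c) x :=
  (hasDerivAt_phi hc hx h).deriv

theorem deriv_deriv_phi (hc : ∀ n, 0 ≤ c n) {x : ℝ} (hx : 0 < x)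
    (h : ENNReal.ofReal x < convRadius c) :
    deriv (deriv (phi c)) x = phi (derivCoeff (derivCoeff c)) x := by
  obtain ⟨y, hxy, hy0, hy⟩ := exists_gt_of_lt_convRadius h
  -- The formula for the first derivative is available on the nonnegative axis only; x > 0 provides
  -- a two-sided neighbourhood there.
  have : deriv (phi c) =ᶠ[𝓝 x] phi (derivCoeff c) := by
    filter_upwards [Ioo_mem_nhds hx hxy] with w hw
    exact deriv_phi hc hw.1.le ((ENNReal.ofReal_le_ofReal hw.2.le).trans_lt hy)
  rw [this.deriv_eq]
  exact deriv_phi (derivCoeff_nonneg hc) hx.le (h.trans_le (convRadius_le_derivCoeff hc))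

/-- A power series with nonnegative coefficients lies above its tangents on the positive axis. -/
theorem phi_tangent_le (hc : ∀ n, 0 ≤ c n) {x y : ℝ} (hx : 0 ≤ x) (hxy : x ≤ y)
    (h : ENNReal.ofReal y < convRadius c) :
    phi (derivCoeff c) x * (y - x) ≤ phi c y - phi c x := by
  have hlt : ∀ w ∈ Set.Icc x y, ENNReal.ofReal w < convRadius c := fun w hw =>
    (ENNReal.ofReal_le_ofReal hw.2).trans_lt h
  refine (convex_Icc x y).mul_sub_le_image_sub_of_le_deriv
    (fun w hw => (hasDerivAt_phi hc (hx.trans hw.1) (hlt w hw)).continuousAt.continuousWithinAt)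
    (fun w hw => ?_) (fun w hw => ?_) x (Set.left_mem_Icc.2 hxy) y (Set.right_mem_Icc.2 hxy) hxy
  · have hw' := interior_subset hw
    exact (hasDerivAt_phi hc (hx.trans hw'.1)
      (hlt w hw')).differentiableAt.differentiableWithinAt
  · have hw' := interior_subset hw
    rw [deriv_phi hc (hx.trans hw'.1) (hlt w hw')]
    exact phi_mono (derivCoeff_nonneg hc) hx hw'.1
      ((hlt w hw').trans_le (convRadius_le_derivCoeff hc))

end PowerSeries

/-! ### The radius of convergence and the critical values -/

section Critical

variable {p : ℕ → ℝ} {β h : ℝ}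

/-- The generating function at a real argument. -/
def genFnReal (p : ℕ → ℝ) (β h : ℝ) (ε : ℤˣ) (g : ℝ) : ℝ := phi (partitionFn p β h ε) g

theorem genFn_ofReal (p : ℕ → ℝ) (β h : ℝ) (ε : ℤˣ) (g : ℝ) :
    genFn p β h ε g = (genFnReal p β h ε g : ℂ) := phiC_ofReal _ _

/-- A finite supersolution at g bounds the series at g, which therefore converges. This yields both
the positivity of g₀ and the contradiction that forces the determinant to vanish. -/
theorem le_convRadius_of_supersolution (hp : ∀ n, 0 ≤ p n) {g : ℝ} (hg : 0 ≤ g) (x : ℤˣ → ℝ)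
    (hx : ∀ ε, 0 ≤ x ε) (hxr : ∀ ε, ENNReal.ofReal (x ε) < convRadius p)
    (hle : ∀ ε, g * edgeFactor β h ε 1 * phi p (x 1) +
      g * edgeFactor β h ε (-1) * phi p (x (-1)) ≤ x ε) (ε : ℤˣ) :
    ENNReal.ofReal g ≤ convRadius (partitionFn p β h ε) := by
  refine le_convRadius_of_summable (partitionFn_nonneg hp β h ε) hg
    (summable_of_phiENN_ne_top (partitionFn_nonneg hp β h ε) hg (ne_top_of_le_ne_top
      ENNReal.ofReal_ne_top (b := ENNReal.ofReal (x ε)) ?_))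
  rw [← genFnENN_eq_phiENN]
  refine genFnENN_le hp β h _ (fun s => ENNReal.ofReal (x s)) (fun s => ?_) ε
  have h0 : ∀ s t, 0 ≤ g * edgeFactor β h s t := fun s t =>
    mul_nonneg hg (edgeFactor_pos β h s t).le
  rw [phiENN_ofReal hp (hx _) (summable_of_lt_convRadius hp (hx _) (hxr _)),
    phiENN_ofReal hp (hx _) (summable_of_lt_convRadius hp (hx _) (hxr _)),
    ← ENNReal.ofReal_mul hg, ← ENNReal.ofReal_mul hg, ← ENNReal.ofReal_mul (h0 _ _),
    ← ENNReal.ofReal_mul (h0 _ _), ← ENNReal.ofReal_add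
      (mul_nonneg (h0 _ _) (phi_nonneg hp (hx _))) (mul_nonneg (h0 _ _) (phi_nonneg hp (hx _)))]
  exact ENNReal.ofReal_le_ofReal (hle s)

theorem critRadius_pos (hp : ∀ n, 0 ≤ p n) (hξ : 0 < convRadius p) :
    0 < critRadius p β h := by
  obtain ⟨R, -, hR0, hR⟩ := exists_gt_of_lt_convRadius (c := p) (x := 0) (by simpa using hξ)
  set F := phi p R
  have hF : 0 ≤ F := phi_nonneg hp hR0.le
  set S := edgeFactor β h 1 1 + edgeFactor β h 1 (-1) + edgeFactor β h (-1) 1 +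
    edgeFactor β h (-1) (-1)
  have hpos := edgeFactor_pos β h
  have hS : ∀ ε, edgeFactor β h ε 1 + edgeFactor β h ε (-1) ≤ S := by
    intro ε
    rcases Int.units_eq_one_or ε with rfl | rfl
    · linarith [hpos (-1) 1, hpos (-1) (-1)]
    · linarith [hpos 1 1, hpos 1 (-1)]
  have hS0 : 0 ≤ S := (add_pos (hpos 1 1) (hpos 1 (-1))).le.trans (hS 1)
  have hd : 0 < S * F + 1 := by positivity
  -- With this g the constant vector R is a supersolution, because S bounds the row sums of the edge
  -- factors; the summand 1 keeps the denominator positive.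
  have hg : 0 < R / (S * F + 1) := by positivity
  refine (ENNReal.ofReal_pos.2 hg).trans_le
    (le_convRadius_of_supersolution hp hg.le (fun _ => R) (fun _ => hR0.le) (fun _ => hR)
      (fun ε => ?_) 1)
  calc _ = R / (S * F + 1) * ((edgeFactor β h ε 1 + edgeFactor β h ε (-1)) * F) := by ring
    _ ≤ R / (S * F + 1) * (S * F + 1) := by
      refine mul_le_mul_of_nonneg_left ?_ hg.le
      linarith [mul_le_mul_of_nonneg_right (hS ε) hF]
    _ = R := div_mul_cancel₀ _ hd.ne'

/-- Both equations involve the same two quantities φ(Z_+) and φ(Z_-) with positive finite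
coefficients, so finiteness of one generating function at a positive argument forces finiteness of
the other. -/
theorem convRadius_partitionFn_le (hp : ∀ n, 0 ≤ p n) (ε ε' : ℤˣ) :
    convRadius (partitionFn p β h ε) ≤ convRadius (partitionFn p β h ε') := by
  refine le_of_forall_lt fun x hx => ?_
  obtain ⟨y, hy1, hy2⟩ := ENNReal.lt_iff_exists_nnreal_btwn.1 hx
  refine hy1.trans_le ?_
  have hy0 : (y : ℝ≥0∞) ≠ 0 := ((zero_le).trans_lt hy1).ne'
  have hZ : genFnENN p β h ε y ≠ ⊤ := by
    rw [← ENNReal.ofReal_coe_nnreal] at hy2 ⊢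
    rw [genFnENN_eq_phiENN, phiENN_ofReal (partitionFn_nonneg hp β h ε) y.coe_nonneg
      (summable_of_lt_convRadius (partitionFn_nonneg hp β h ε) y.coe_nonneg hy2)]
    exact ENNReal.ofReal_ne_top
  have hfac : ∀ s t, (y : ℝ≥0∞) * ENNReal.ofReal (edgeFactor β h s t) ≠ 0 := fun s t =>
    mul_ne_zero hy0 (ENNReal.ofReal_pos.2 (edgeFactor_pos β h s t)).ne'
  have hfac' : ∀ s t, (y : ℝ≥0∞) * ENNReal.ofReal (edgeFactor β h s t) ≠ ⊤ := fun s t =>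
    ENNReal.mul_ne_top ENNReal.coe_ne_top ENNReal.ofReal_ne_top
  rw [genFnENN_eq hp, ENNReal.add_ne_top] at hZ
  have h1 := ENNReal.lt_top_of_mul_ne_top_right hZ.1 (hfac _ _)
  have h2 := ENNReal.lt_top_of_mul_ne_top_right hZ.2 (hfac _ _)
  have hZ' : genFnENN p β h ε' y ≠ ⊤ := by
    rw [genFnENN_eq hp, ENNReal.add_ne_top]
    exact ⟨ENNReal.mul_ne_top (hfac' _ _) h1.ne, ENNReal.mul_ne_top (hfac' _ _) h2.ne⟩
  rw [← ENNReal.ofReal_coe_nnreal] at hZ' ⊢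
  exact le_convRadius_of_summable (partitionFn_nonneg hp β h ε') y.coe_nonneg
    (summable_of_phiENN_ne_top (partitionFn_nonneg hp β h ε') y.coe_nonneg hZ')

theorem convRadius_partitionFn (hp : ∀ n, 0 ≤ p n) (ε : ℤˣ) :
    convRadius (partitionFn p β h ε) = critRadius p β h :=
  le_antisymm (convRadius_partitionFn_le hp ε 1) (convRadius_partitionFn_le hp 1 ε)

theorem critRadius_lt_top (hp : ∀ n, 0 ≤ p n) (hp0 : p 0 ≠ 0) (hp2 : ∃ n, 2 ≤ n ∧ p n ≠ 0) :
    critRadius p β h < ⊤ := by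
  obtain ⟨n, hn, hpn⟩ := hp2
  rw [lt_top_iff_ne_top]
  intro htop
  have ha : 0 < edgeFactor β h 1 1 := edgeFactor_pos _ _ _ _
  have h0 : 0 < p 0 := (hp 0).lt_of_ne' hp0
  have hn0 : 0 < p n := (hp n).lt_of_ne' hpn
  set A := edgeFactor β h 1 1
  -- The equation gives z ≥ g A p_m z^m for every m. The first summand of g then forces z ≥ 1, and
  -- the second forces z ≥ 2 z^n, which is incompatible with z ≤ z^n.
  set g : ℝ := 1 / (A * p 0) + 2 / (A * p n)
  have hg : 0 < g := by positivity
  have hZ : genFnENN p β h 1 (ENNReal.ofReal g) =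
      ENNReal.ofReal (genFnReal p β h 1 g) :=
    phiENN_ofReal (partitionFn_nonneg hp β h 1) hg.le
      (summable_of_lt_convRadius (partitionFn_nonneg hp β h 1) hg.le
        (by
          rw [show convRadius (partitionFn p β h 1) = ⊤ from htop]
          exact ENNReal.ofReal_lt_top))
  set z := genFnReal p β h 1 g
  have hz : 0 ≤ z := phi_nonneg (partitionFn_nonneg hp β h 1) hg.le
  have hlow : ∀ m, g * A * (p m * z ^ m) ≤ z := by
    intro m
    rw [← ENNReal.ofReal_le_ofReal_iff hz, ← hZ, genFnENN_eq hp, hZ,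
      ENNReal.ofReal_mul (by positivity), ENNReal.ofReal_mul hg.le, ENNReal.ofReal_mul (hp m),
      ENNReal.ofReal_pow hz]
    exact le_trans (mul_le_mul_right (ENNReal.le_tsum m) _) le_self_add
  have hg1 : 1 ≤ g * A * p 0 := by
    have : g * A * p 0 = 1 + 2 * p 0 / p n := by simp only [g]; field_simp
    rw [this]; linarith [show 0 < 2 * p 0 / p n by positivity]
  have hg2 : 2 ≤ g * A * p n := by
    have : g * A * p n = 2 + p n / p 0 := by simp only [g]; field_simp; ring
    rw [this]; linarith [show 0 < p n / p 0 by positivity]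
  have hz1 : 1 ≤ z := by have := hlow 0; simp at this; linarith
  have hzn : z ≤ z ^ n := le_self_pow₀ hz1 (by omega)
  have := hlow n
  nlinarith

theorem genFnENN_mono (p : ℕ → ℝ) (β h : ℝ) (ε : ℤˣ) : Monotone (genFnENN p β h ε) :=
  phiENN_mono _

theorem tendsto_genFnENN (p : ℕ → ℝ) (β h : ℝ) (ε : ℤˣ) :
    Filter.Tendsto (genFnENN p β h ε) (𝓝[<] critRadius p β h) (𝓝 (critValue p β h ε)) :=
  (genFnENN_mono p β h ε).tendsto_leftLim _

/-- The series is a supremum of finite partial sums, each continuous in g, so it is left-continuous.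
Hence a finite critical value means convergence at g₀ itself. -/
theorem critValue_eq (h0 : 0 < critRadius p β h) (ε : ℤˣ) :
    critValue p β h ε = genFnENN p β h ε (critRadius p β h) := by
  refine le_antisymm ((genFnENN_mono p β h ε).leftLim_le le_rfl) ?_
  have : (𝓝[<] critRadius p β h).NeBot := nhdsLT_neBot_of_exists_lt ⟨0, h0⟩
  rw [genFnENN, ENNReal.tsum_eq_iSup_sum]
  refine iSup_le fun F => ?_
  refine le_of_tendsto_of_tendsto (b := 𝓝[<] critRadius p β h)
    (f := fun g => ∑ N ∈ F, ENNReal.ofReal (partitionFn p β h ε N) * g ^ N) ?_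
    (tendsto_genFnENN p β h ε) (Filter.Eventually.of_forall fun g => ENNReal.sum_le_tsum F)
  refine tendsto_finsetSum F fun N _ => ?_
  refine tendsto_nhdsWithin_of_tendsto_nhds ?_
  exact ENNReal.Tendsto.const_mul ((ENNReal.continuous_pow N).tendsto _)
    (Or.inr ENNReal.ofReal_ne_top)

theorem g0_pos (h0 : 0 < critRadius p β h) (h1 : critRadius p β h < ⊤) : 0 < g0 p β h :=
  ENNReal.toReal_pos h0.ne' h1.ne

theorem ofReal_g0 (h1 : critRadius p β h < ⊤) : ENNReal.ofReal (g0 p β h) = critRadius p β h :=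
  ENNReal.ofReal_toReal h1.ne

theorem IsGeneric.critValue_lt (hgen : IsGeneric p β h) (ε : ℤˣ) :
    critValue p β h ε < convRadius p := by
  rcases Int.units_eq_one_or ε with rfl | rfl
  exacts [hgen.1, hgen.2]

theorem IsGeneric.ofReal_Z0 (hgen : IsGeneric p β h) (ε : ℤˣ) :
    ENNReal.ofReal (Z0 p β h ε) = critValue p β h ε :=
  ENNReal.ofReal_toReal ((hgen.critValue_lt ε).trans_le le_top).ne

theorem IsGeneric.Z0_lt (hgen : IsGeneric p β h) (ε : ℤˣ) :
    ENNReal.ofReal (Z0 p β h ε) < convRadius p := by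
  rw [hgen.ofReal_Z0]; exact hgen.critValue_lt ε

theorem Z0_nonneg (p : ℕ → ℝ) (β h : ℝ) (ε : ℤˣ) : 0 ≤ Z0 p β h ε := ENNReal.toReal_nonneg

variable (hp : ∀ n, 0 ≤ p n) (h0 : 0 < critRadius p β h) (h1 : critRadius p β h < ⊤)
  (hgen : IsGeneric p β h)

include hp h0 h1 hgen

theorem summable_partitionFn {g : ℝ} (hg : 0 ≤ g) (hg' : g ≤ g0 p β h) (ε : ℤˣ) :
    Summable fun n => partitionFn p β h ε n * g ^ n := by
  refine summable_of_phiENN_ne_top (partitionFn_nonneg hp β h ε) hg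
    (ne_top_of_le_ne_top (ENNReal.ofReal_ne_top (r := Z0 p β h ε)) ?_)
  rw [hgen.ofReal_Z0, critValue_eq h0, ← ofReal_g0 h1]
  exact genFnENN_mono p β h ε (ENNReal.ofReal_le_ofReal hg')

theorem genFnENN_ofReal {g : ℝ} (hg : 0 ≤ g) (hg' : g ≤ g0 p β h) (ε : ℤˣ) :
    genFnENN p β h ε (ENNReal.ofReal g) = ENNReal.ofReal (genFnReal p β h ε g) :=
  phiENN_ofReal (partitionFn_nonneg hp β h ε) hg (summable_partitionFn hp h0 h1 hgen hg hg' ε)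

omit h0 h1 hgen in
theorem genFnReal_nonneg {g : ℝ} (hg : 0 ≤ g) (ε : ℤˣ) : 0 ≤ genFnReal p β h ε g :=
  phi_nonneg (partitionFn_nonneg hp β h ε) hg

theorem genFnReal_g0 (ε : ℤˣ) : genFnReal p β h ε (g0 p β h) = Z0 p β h ε := by
  have := genFnENN_ofReal hp h0 h1 hgen (g0_pos h0 h1).le le_rfl ε
  rw [ofReal_g0 h1, ← critValue_eq h0, ← hgen.ofReal_Z0] at this
  exact ((ENNReal.ofReal_eq_ofReal_iff (Z0_nonneg _ _ _ _)
    (genFnReal_nonneg hp (g0_pos h0 h1).le ε)).1 this).symm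

theorem genFnReal_le {g : ℝ} (hg : 0 ≤ g) (hg' : g ≤ g0 p β h) (ε : ℤˣ) :
    genFnReal p β h ε g ≤ Z0 p β h ε := by
  rw [← genFnReal_g0 hp h0 h1 hgen ε]
  exact Summable.tsum_le_tsum
    (fun n => mul_le_mul_of_nonneg_left (pow_le_pow_left₀ hg hg' n) (partitionFn_nonneg hp β h ε n))
    (summable_partitionFn hp h0 h1 hgen hg hg' ε)
    (summable_partitionFn hp h0 h1 hgen (g0_pos h0 h1).le le_rfl ε)

theorem genFnReal_lt_convRadius {g : ℝ} (hg : 0 ≤ g) (hg' : g ≤ g0 p β h) (ε : ℤˣ) :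
    ENNReal.ofReal (genFnReal p β h ε g) < convRadius p :=
  (ENNReal.ofReal_le_ofReal (genFnReal_le hp h0 h1 hgen hg hg' ε)).trans_lt (hgen.Z0_lt ε)

theorem genFnReal_eq {g : ℝ} (hg : 0 ≤ g) (hg' : g ≤ g0 p β h) (ε : ℤˣ) :
    genFnReal p β h ε g = g * edgeFactor β h ε 1 * phi p (genFnReal p β h 1 g) +
      g * edgeFactor β h ε (-1) * phi p (genFnReal p β h (-1) g) := by
  have hfac : ∀ s t, 0 ≤ g * edgeFactor β h s t := fun s t =>
    mul_nonneg hg (edgeFactor_pos β h s t).le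
  have hn := fun s => genFnReal_nonneg hp (β := β) (h := h) hg s
  have hs := fun s => summable_of_lt_convRadius hp (hn s)
    (genFnReal_lt_convRadius hp h0 h1 hgen hg hg' s)
  have := genFnENN_eq hp β h ε (ENNReal.ofReal g)
  rw [genFnENN_ofReal hp h0 h1 hgen hg hg', genFnENN_ofReal hp h0 h1 hgen hg hg',
    genFnENN_ofReal hp h0 h1 hgen hg hg', phiENN_ofReal hp (hn _) (hs _),
    phiENN_ofReal hp (hn _) (hs _), ← ENNReal.ofReal_mul hg, ← ENNReal.ofReal_mul hg,
    ← ENNReal.ofReal_mul (hfac _ _), ← ENNReal.ofReal_mul (hfac _ _), ← ENNReal.ofReal_add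
      (mul_nonneg (hfac _ _) (phi_nonneg hp (hn _)))
      (mul_nonneg (hfac _ _) (phi_nonneg hp (hn _)))] at this
  exact (ENNReal.ofReal_eq_ofReal_iff (hn _) (add_nonneg
    (mul_nonneg (hfac _ _) (phi_nonneg hp (hn _)))
    (mul_nonneg (hfac _ _) (phi_nonneg hp (hn _))))).1 this

theorem tendsto_genFnReal (ε : ℤˣ) :
    Filter.Tendsto (genFnReal p β h ε) (𝓝[<] g0 p β h) (𝓝 (Z0 p β h ε)) := by
  have hlim : Filter.Tendsto ENNReal.ofReal (𝓝[<] g0 p β h) (𝓝[<] critRadius p β h) := by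
    refine tendsto_nhdsWithin_iff.2 ⟨?_, ?_⟩
    · rw [← ofReal_g0 h1]
      exact tendsto_nhdsWithin_of_tendsto_nhds (ENNReal.continuous_ofReal.tendsto _)
    · filter_upwards [self_mem_nhdsWithin] with g hg
      rw [Set.mem_Iio, ← ofReal_g0 h1]
      exact (ENNReal.ofReal_lt_ofReal_iff (g0_pos h0 h1)).2 hg
  have := (ENNReal.tendsto_toReal ((hgen.critValue_lt ε).trans_le le_top).ne).comp
    ((tendsto_genFnENN p β h ε).comp hlim)
  refine this.congr' ?_
  filter_upwards [Ioo_mem_nhdsLT (g0_pos h0 h1)] with g hg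
  simp only [Function.comp_apply]
  rw [genFnENN_ofReal hp h0 h1 hgen hg.1.le hg.2.le, ENNReal.toReal_ofReal
    (genFnReal_nonneg hp hg.1.le ε)]

theorem genFnReal_pos (hp0 : p 0 ≠ 0) {g : ℝ} (hg : 0 < g) (hg' : g ≤ g0 p β h) (ε : ℤˣ) :
    0 < genFnReal p β h ε g := by
  rw [genFnReal_eq hp h0 h1 hgen hg.le hg']
  have hφ : ∀ s, 0 < phi p (genFnReal p β h s g) := fun s => by
    have := term_le_phi hp (genFnReal_nonneg hp hg.le s)
      (genFnReal_lt_convRadius hp h0 h1 hgen hg.le hg' s) 0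
    have h00 := (hp 0).lt_of_ne' hp0
    simp at this
    linarith
  have := edgeFactor_pos β h
  exact add_pos (mul_pos (mul_pos hg (this _ _)) (hφ _)) (mul_pos (mul_pos hg (this _ _)) (hφ _))

end Critical

/-! ### Vanishing of the determinant at the critical point -/

section Determinant

variable {p : ℕ → ℝ} {β h : ℝ}

theorem a_pos (β h : ℝ) : 0 < a β h := Real.exp_pos _

theorem b_pos (β h : ℝ) : 0 < b β h := Real.exp_pos _

theorem det_one_sub_smul_PhiPrime (p : ℕ → ℝ) (β h x y g : ℝ) :
    (1 - g • PhiPrime p β h x y).det =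
      (1 - g * a β h * deriv (phi p) x) * (1 - g * (b β h)⁻¹ * deriv (phi p) y) -
        g * (a β h)⁻¹ * deriv (phi p) y * (g * b β h * deriv (phi p) x) := by
  rw [Matrix.det_fin_two]
  simp [PhiPrime]
  ring

theorem exists_derivCoeff_ne_zero (hp2 : ∃ n, 2 ≤ n ∧ p n ≠ 0) :
    (∃ n, derivCoeff p n ≠ 0) ∧ ∃ n, derivCoeff (derivCoeff p) n ≠ 0 := by
  obtain ⟨n, hn, hpn⟩ := hp2
  obtain ⟨m, rfl⟩ := Nat.exists_eq_add_of_le' hn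
  refine ⟨⟨m + 1, mul_ne_zero (by positivity) hpn⟩, ⟨m, ?_⟩⟩
  exact mul_ne_zero (by positivity) (mul_ne_zero (by positivity) hpn)

variable (hp : ∀ n, 0 ≤ p n) (h0 : 0 < critRadius p β h) (h1 : critRadius p β h < ⊤)
  (hgen : IsGeneric p β h)

include hp h0 h1 hgen

theorem Z0_pos (hp0 : p 0 ≠ 0) (ε : ℤˣ) : 0 < Z0 p β h ε := by
  rw [← genFnReal_g0 hp h0 h1 hgen]
  exact genFnReal_pos hp h0 h1 hgen hp0 (g0_pos h0 h1) le_rfl ε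

theorem genFnReal_one_eq {g : ℝ} (hg : 0 ≤ g) (hg' : g ≤ g0 p β h) :
    genFnReal p β h 1 g = g * (a β h * phi p (genFnReal p β h 1 g) +
      (a β h)⁻¹ * phi p (genFnReal p β h (-1) g)) := by
  conv_lhs => rw [genFnReal_eq hp h0 h1 hgen hg hg', edgeFactor_one_one, edgeFactor_one_neg]
  ring

theorem genFnReal_neg_eq {g : ℝ} (hg : 0 ≤ g) (hg' : g ≤ g0 p β h) :
    genFnReal p β h (-1) g = g * (b β h * phi p (genFnReal p β h 1 g) +
      (b β h)⁻¹ * phi p (genFnReal p β h (-1) g)) := by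
  conv_lhs => rw [genFnReal_eq hp h0 h1 hgen hg hg', edgeFactor_neg_one, edgeFactor_neg_neg]
  ring

theorem Z0_one_eq : Z0 p β h 1 = g0 p β h * (a β h * phi p (Z0 p β h 1) +
    (a β h)⁻¹ * phi p (Z0 p β h (-1))) := by
  simpa only [genFnReal_g0 hp h0 h1 hgen] using
    genFnReal_one_eq hp h0 h1 hgen (g0_pos h0 h1).le le_rfl

theorem Z0_neg_eq : Z0 p β h (-1) = g0 p β h * (b β h * phi p (Z0 p β h 1) +
    (b β h)⁻¹ * phi p (Z0 p β h (-1))) := by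
  simpa only [genFnReal_g0 hp h0 h1 hgen] using
    genFnReal_neg_eq hp h0 h1 hgen (g0_pos h0 h1).le le_rfl

/-- Below the critical point the matrix `g Φ'` has spectral radius less than one. -/
theorem subcritical (hp0 : p 0 ≠ 0) {g : ℝ} (hg : 0 < g) (hg' : g < g0 p β h) :
    g * a β h * phi (derivCoeff p) (genFnReal p β h 1 g) < 1 ∧
    g * (b β h)⁻¹ * phi (derivCoeff p) (genFnReal p β h (-1) g) < 1 ∧
    0 ≤ (1 - g * a β h * phi (derivCoeff p) (genFnReal p β h 1 g)) *
        (1 - g * (b β h)⁻¹ * phi (derivCoeff p) (genFnReal p β h (-1) g)) -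
      g * (a β h)⁻¹ * phi (derivCoeff p) (genFnReal p β h (-1) g) *
        (g * b β h * phi (derivCoeff p) (genFnReal p β h 1 g)) := by
  have ex := genFnReal_one_eq hp h0 h1 hgen hg.le hg'.le
  have ey := genFnReal_neg_eq hp h0 h1 hgen hg.le hg'.le
  have ex0 := Z0_one_eq hp h0 h1 hgen
  have ey0 := Z0_neg_eq hp h0 h1 hgen
  have hx := genFnReal_nonneg hp (β := β) (h := h) hg.le 1
  have hy := genFnReal_nonneg hp (β := β) (h := h) hg.le (-1)
  have hxx0 := genFnReal_le hp h0 h1 hgen hg.le hg'.le 1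
  have hyy0 := genFnReal_le hp h0 h1 hgen hg.le hg'.le (-1)
  have tx := phi_tangent_le hp hx hxx0 (hgen.Z0_lt 1)
  have ty := phi_tangent_le hp hy hyy0 (hgen.Z0_lt (-1))
  have px0 := phi_pos hp (Z0_pos hp h0 h1 hgen hp0 1) (hgen.Z0_lt 1) hp0
  have py0 := phi_pos hp (Z0_pos hp h0 h1 hgen hp0 (-1)) (hgen.Z0_lt (-1)) hp0
  have dx := phi_nonneg (derivCoeff_nonneg hp) hx
  have dy := phi_nonneg (derivCoeff_nonneg hp) hy
  have ha := a_pos β h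
  have hb := b_pos β h
  have ha' := inv_pos.2 ha
  have hb' := inv_pos.2 hb
  generalize genFnReal p β h 1 g = x at *
  generalize genFnReal p β h (-1) g = y at *
  generalize Z0 p β h 1 = x₀ at *
  generalize Z0 p β h (-1) = y₀ at *
  generalize g0 p β h = G at *
  generalize (a β h)⁻¹ = A' at *
  generalize (b β h)⁻¹ = B' at *
  generalize a β h = A at *
  generalize b β h = B at *
  generalize phi (derivCoeff p) x = X' at *
  generalize phi (derivCoeff p) y = Y' at *
  have hu0 : 0 ≤ x₀ - x := by linarith
  have hv0 : 0 ≤ y₀ - y := by linarith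
  -- The tangent inequality for φ, weighted by one row of the system. Strictness comes from g < G
  -- and φ > 0 at the critical values.
  have key : ∀ {C D : ℝ}, 0 < C → 0 < D →
      g * C * X' * (x₀ - x) + g * D * Y' * (y₀ - y) <
        G * (C * phi p x₀ + D * phi p y₀) - g * (C * phi p x + D * phi p y) := by
    intro C D hC hD
    have e1 := mul_le_mul_of_nonneg_left tx (mul_pos hg hC).le
    have e2 := mul_le_mul_of_nonneg_left ty (mul_pos hg hD).le
    have e3 : 0 < (G - g) * (C * phi p x₀ + D * phi p y₀) :=
      mul_pos (sub_pos.2 hg') (by positivity)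
    nlinarith
  have hu := key ha ha'
  have hv := key hb hb'
  rw [← ex, ← ex0] at hu
  rw [← ey, ← ey0] at hv
  set u := x₀ - x
  set v := y₀ - y
  have n12 : 0 ≤ g * A' * Y' := by positivity
  have n21 : 0 ≤ g * B * X' := by positivity
  have n11 : 0 ≤ g * A * X' := by positivity
  have n22 : 0 ≤ g * B' * Y' := by positivity
  set m11 := g * A * X'
  set m12 := g * A' * Y'
  set m21 := g * B * X'
  set m22 := g * B' * Y'
  have hupos : 0 < u := lt_of_le_of_lt (by positivity) hu
  have hvpos : 0 < v := lt_of_le_of_lt (by positivity) hv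
  have k1 : m12 * v < (1 - m11) * u := by linarith
  have k2 : m21 * u < (1 - m22) * v := by linarith
  have l1 : 0 < 1 - m11 := pos_of_mul_pos_left ((mul_nonneg n12 hv0).trans_lt k1) hu0
  have l2 : 0 < 1 - m22 := pos_of_mul_pos_left ((mul_nonneg n21 hu0).trans_lt k2) hv0
  refine ⟨by linarith, by linarith, ?_⟩
  -- Multiplying the two inequalities and cancelling u v > 0 leaves the sign of the determinant.
  have := mul_le_mul k1.le k2.le (mul_nonneg n21 hu0) (mul_pos l1 hupos).le
  have : 0 ≤ ((1 - m11) * (1 - m22) - m12 * m21) * (u * v) := by linarith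
  exact nonneg_of_mul_nonneg_left this (mul_pos hupos hvpos)

theorem tendsto_derivCoeff_genFnReal (ε : ℤˣ) :
    Filter.Tendsto (fun g => phi (derivCoeff p) (genFnReal p β h ε g)) (𝓝[<] g0 p β h)
      (𝓝 (phi (derivCoeff p) (Z0 p β h ε))) :=
  (hasDerivAt_phi (derivCoeff_nonneg hp) (Z0_nonneg p β h ε)
    ((hgen.Z0_lt ε).trans_le (convRadius_le_derivCoeff hp))).continuousAt.tendsto.comp
    (tendsto_genFnReal hp h0 h1 hgen ε)

/-- The limit g ↗ g₀ preserves only weak inequalities; strictness on the diagonal is recovered in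
`critical_matrix`. -/
theorem critical_le (hp0 : p 0 ≠ 0) :
    g0 p β h * a β h * phi (derivCoeff p) (Z0 p β h 1) ≤ 1 ∧
    g0 p β h * (b β h)⁻¹ * phi (derivCoeff p) (Z0 p β h (-1)) ≤ 1 ∧
    0 ≤ (1 - g0 p β h * a β h * phi (derivCoeff p) (Z0 p β h 1)) *
        (1 - g0 p β h * (b β h)⁻¹ * phi (derivCoeff p) (Z0 p β h (-1))) -
      g0 p β h * (a β h)⁻¹ * phi (derivCoeff p) (Z0 p β h (-1)) *
        (g0 p β h * b β h * phi (derivCoeff p) (Z0 p β h 1)) := by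
  have tx := tendsto_derivCoeff_genFnReal hp h0 h1 hgen 1
  have ty := tendsto_derivCoeff_genFnReal hp h0 h1 hgen (-1)
  have tg : Filter.Tendsto (fun g : ℝ => g) (𝓝[<] g0 p β h) (𝓝 (g0 p β h)) :=
    tendsto_nhdsWithin_of_tendsto_nhds Filter.tendsto_id
  have hev : ∀ᶠ g in 𝓝[<] g0 p β h, g ∈ Set.Ioo 0 (g0 p β h) := Ioo_mem_nhdsLT (g0_pos h0 h1)
  have t11 := (tg.mul_const (a β h)).mul tx
  have t22 := (tg.mul_const (b β h)⁻¹).mul ty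
  have t12 := (tg.mul_const (a β h)⁻¹).mul ty
  have t21 := (tg.mul_const (b β h)).mul tx
  refine ⟨le_of_tendsto t11 ?_, le_of_tendsto t22 ?_, ge_of_tendsto
    (((t11.const_sub 1).mul (t22.const_sub 1)).sub (t12.mul t21)) ?_⟩
  · exact hev.mono fun g hg => (subcritical hp h0 h1 hgen hp0 hg.1 hg.2).1.le
  · exact hev.mono fun g hg => (subcritical hp h0 h1 hgen hp0 hg.1 hg.2).2.1.le
  · exact hev.mono fun g hg => (subcritical hp h0 h1 hgen hp0 hg.1 hg.2).2.2

/-- If `v` is a positive vector with `g₀ Φ' v < v`, the recursion has a supersolution beyond the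
radius of convergence. -/
theorem not_exists_contracted_vector (v : ℤˣ → ℝ) (hv : ∀ ε, 0 < v ε)
    (hlt : ∀ ε, g0 p β h * edgeFactor β h ε 1 * (phi (derivCoeff p) (Z0 p β h 1) * v 1) +
      g0 p β h * edgeFactor β h ε (-1) * (phi (derivCoeff p) (Z0 p β h (-1)) * v (-1)) < v ε) :
    False := by
  have hcomp : ∀ s, HasDerivAt (fun δ : ℝ => phi p (Z0 p β h s + δ * v s))
      (phi (derivCoeff p) (Z0 p β h s) * v s) 0 := by
    intro s
    have hin : HasDerivAt (fun δ : ℝ => Z0 p β h s + δ * v s) (v s) 0 := by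
      simpa using ((hasDerivAt_id (0 : ℝ)).mul_const (v s)).const_add (Z0 p β h s)
    have hout : HasDerivAt (phi p) (phi (derivCoeff p) (Z0 p β h s)) (Z0 p β h s + 0 * v s) := by
      simpa using hasDerivAt_phi hp (Z0_nonneg p β h s) (hgen.Z0_lt s)
    exact hout.comp (0 : ℝ) hin
  -- At δ = 0 both sides agree by the critical equation, and the left side has the smaller
  -- derivative, so it is smaller for small δ > 0.
  have hF : ∀ ε, ∀ᶠ δ in 𝓝[>] (0 : ℝ), g0 p β h * edgeFactor β h ε 1 *
      phi p (Z0 p β h 1 + δ * v 1) + g0 p β h * edgeFactor β h ε (-1) *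
      phi p (Z0 p β h (-1) + δ * v (-1)) < Z0 p β h ε + δ * v ε := by
    intro ε
    have hd := (((hcomp 1).const_mul (g0 p β h * edgeFactor β h ε 1)).add
      ((hcomp (-1)).const_mul (g0 p β h * edgeFactor β h ε (-1))))
    have hs := (hasDerivAt_iff_tendsto_slope_zero.1 hd).mono_left
      (nhdsWithin_mono (0 : ℝ) (fun x (hx : 0 < x) => (ne_of_gt hx : x ∈ ({0}ᶜ : Set ℝ))))
    filter_upwards [hs.eventually (gt_mem_nhds (hlt ε)), self_mem_nhdsWithin] with δ hδ hδ0
    have hδ0 : 0 < δ := hδ0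
    have e0 := genFnReal_eq hp h0 h1 hgen (g0_pos h0 h1).le le_rfl ε
    simp only [genFnReal_g0 hp h0 h1 hgen] at e0
    simp only [zero_add, zero_mul, add_zero, Pi.add_apply, smul_eq_mul] at hδ
    rw [← e0, inv_mul_lt_iff₀ hδ0] at hδ
    linarith
  have hR : ∀ ε, ∀ᶠ δ in 𝓝[>] (0 : ℝ), ENNReal.ofReal (Z0 p β h ε + δ * v ε) < convRadius p := by
    intro ε
    have hc : Continuous fun δ : ℝ => ENNReal.ofReal (Z0 p β h ε + δ * v ε) :=
      ENNReal.continuous_ofReal.comp (by fun_prop)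
    refine (tendsto_nhdsWithin_of_tendsto_nhds (hc.tendsto 0)).eventually (gt_mem_nhds ?_)
    simpa using hgen.Z0_lt ε
  obtain ⟨δ, f1, f2, r1, r2, hδ⟩ := ((hF 1).and ((hF (-1)).and ((hR 1).and ((hR (-1)).and
    self_mem_nhdsWithin)))).exists
  have hδ : 0 < δ := hδ
  -- For fixed δ the strict inequality is open in g, so it survives slightly above g₀.
  have hG : ∀ ε, g0 p β h * edgeFactor β h ε 1 * phi p (Z0 p β h 1 + δ * v 1) +
      g0 p β h * edgeFactor β h ε (-1) * phi p (Z0 p β h (-1) + δ * v (-1)) <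
        Z0 p β h ε + δ * v ε → ∀ᶠ g in 𝓝[>] g0 p β h,
      g * edgeFactor β h ε 1 * phi p (Z0 p β h 1 + δ * v 1) +
      g * edgeFactor β h ε (-1) * phi p (Z0 p β h (-1) + δ * v (-1)) <
        Z0 p β h ε + δ * v ε := by
    intro ε hε
    have hc : Continuous fun g : ℝ => g * edgeFactor β h ε 1 * phi p (Z0 p β h 1 + δ * v 1) +
      g * edgeFactor β h ε (-1) * phi p (Z0 p β h (-1) + δ * v (-1)) := by fun_prop
    exact (tendsto_nhdsWithin_of_tendsto_nhds (hc.tendsto (g0 p β h))).eventually (gt_mem_nhds hε)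
  obtain ⟨g, k1, k2, hg⟩ := ((hG 1 f1).and ((hG (-1) f2).and self_mem_nhdsWithin)).exists
  have hg : g0 p β h < g := hg
  have hg0 : 0 < g := (g0_pos h0 h1).trans hg
  have hle := le_convRadius_of_supersolution hp hg0.le (fun ε => Z0 p β h ε + δ * v ε)
    (fun ε => add_nonneg (Z0_nonneg p β h ε) (mul_pos hδ (hv ε)).le)
    (fun ε => by rcases Int.units_eq_one_or ε with rfl | rfl; exacts [r1, r2])
    (fun ε => by rcases Int.units_eq_one_or ε with rfl | rfl; exacts [k1.le, k2.le]) 1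
  rw [show convRadius (partitionFn p β h 1) = critRadius p β h from rfl, ← ofReal_g0 h1,
    ENNReal.ofReal_le_ofReal_iff (g0_pos h0 h1).le] at hle
  linarith

theorem det_eq_zero (hp0 : p 0 ≠ 0) :
    (1 - g0 p β h * a β h * phi (derivCoeff p) (Z0 p β h 1)) *
        (1 - g0 p β h * (b β h)⁻¹ * phi (derivCoeff p) (Z0 p β h (-1))) -
      g0 p β h * (a β h)⁻¹ * phi (derivCoeff p) (Z0 p β h (-1)) *
        (g0 p β h * b β h * phi (derivCoeff p) (Z0 p β h 1)) = 0 := by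
  obtain ⟨l1, l2, hdet⟩ := critical_le hp h0 h1 hgen hp0
  refine le_antisymm ?_ hdet
  by_contra! hpos
  have dx := phi_nonneg (derivCoeff_nonneg hp) (Z0_nonneg p β h 1)
  have dy := phi_nonneg (derivCoeff_nonneg hp) (Z0_nonneg p β h (-1))
  have ha := a_pos β h
  have hb := b_pos β h
  have hg := g0_pos h0 h1
  -- The vector v is the adjugate of 1 - g₀ Φ' applied to (1, 1), so that (1 - g₀ Φ') v = det · (1,
  -- 1) is positive.
  have hcon := not_exists_contracted_vector hp h0 h1 hgen
    (fun ε => if ε = 1 then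
      (1 - g0 p β h * (b β h)⁻¹ * phi (derivCoeff p) (Z0 p β h (-1))) +
        g0 p β h * (a β h)⁻¹ * phi (derivCoeff p) (Z0 p β h (-1))
      else (1 - g0 p β h * a β h * phi (derivCoeff p) (Z0 p β h 1)) +
        g0 p β h * b β h * phi (derivCoeff p) (Z0 p β h 1))
  have n12 : 0 ≤ g0 p β h * (a β h)⁻¹ * phi (derivCoeff p) (Z0 p β h (-1)) := by positivity
  have n21 : 0 ≤ g0 p β h * b β h * phi (derivCoeff p) (Z0 p β h 1) := by positivity
  have hne : (-1 : ℤˣ) ≠ 1 := by decide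
  have hprod : 0 < (1 - g0 p β h * a β h * phi (derivCoeff p) (Z0 p β h 1)) *
      (1 - g0 p β h * (b β h)⁻¹ * phi (derivCoeff p) (Z0 p β h (-1))) := by
    linarith [mul_nonneg n12 n21]
  have q1 := pos_of_mul_pos_left hprod (by linarith)
  have q2 := pos_of_mul_pos_right hprod (by linarith)
  refine hcon (fun ε => ?_) (fun ε => ?_)
  · rcases Int.units_eq_one_or ε with rfl | rfl
    · rw [if_pos rfl]; linarith
    · rw [if_neg hne]; linarith
  · rcases Int.units_eq_one_or ε with rfl | rfl
    · rw [if_pos rfl, if_neg hne, edgeFactor_one_one, edgeFactor_one_neg]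
      linarith
    · rw [if_pos rfl, if_neg hne, edgeFactor_neg_one, edgeFactor_neg_neg]
      linarith

end Determinant

/-! ### From an analytic function of √(x - g) to a square root singularity -/

section SquareRoot

/-- The even and odd parts of an analytic function are functions of the square. -/
theorem exists_even_odd_split {ψ : ℂ → ℂ} (hψ : AnalyticAt ℂ ψ 0) :
    ∃ ρ : ℝ, 0 < ρ ∧ ∃ A B : ℂ → ℂ,
      DifferentiableOn ℂ A (Metric.ball 0 (ρ ^ 2)) ∧
      DifferentiableOn ℂ B (Metric.ball 0 (ρ ^ 2)) ∧
      (∀ q : ℂ, ‖q‖ < ρ → ψ q = A (q ^ 2) - B (q ^ 2) * q) ∧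
      A 0 = ψ 0 ∧ B 0 = -deriv ψ 0 := by
  obtain ⟨P, r, hP⟩ := hψ
  obtain ⟨ρ, hρ0, hρ⟩ := ENNReal.lt_iff_exists_nnreal_btwn.1 hP.r_pos
  have hρ0 : 0 < (ρ : ℝ) := by exact_mod_cast hρ0
  set c := P.coeff
  have hnorm : ∀ n, ‖P n‖ = ‖c n‖ := fun n => (P.norm_apply_eq_norm_coef)
  have hs : Summable fun n => ‖c n‖ * (ρ : ℝ) ^ n := by
    simpa [hnorm] using P.summable_norm_mul_pow (hρ.trans_le hP.r_le)
  have hsum : ∀ q : ℂ, ‖q‖ < ρ → HasSum (fun n => c n * q ^ n) (ψ q) := by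
    intro q hq
    have := hP.hasSum (y := q) (by
      simp only [Metric.mem_eball, edist_zero_right]
      refine lt_trans ?_ hρ
      rw [← ofReal_norm, ← ENNReal.ofReal_coe_nnreal]
      exact (ENNReal.ofReal_lt_ofReal_iff hρ0).2 hq)
    simp only [zero_add] at this
    refine this.congr_fun fun n => ?_
    rw [P.apply_eq_pow_smul_coeff, smul_eq_mul, mul_comm]
  have hse : Summable fun n => ‖c (2 * n)‖ * ((ρ : ℝ) ^ 2) ^ n := by
    refine (hs.comp_injective (i := fun n => 2 * n) fun a b hab => by simpa using hab).congr
      fun n => ?_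
    simp only [Function.comp_apply, pow_mul]
  have hso : Summable fun n => ‖c (2 * n + 1)‖ * ((ρ : ℝ) ^ 2) ^ n := by
    refine ((hs.comp_injective (i := fun n => 2 * n + 1)
      fun a b hab => by simpa using hab).mul_right (ρ : ℝ)⁻¹).congr fun n => ?_
    simp only [Function.comp_apply, pow_succ, pow_mul]
    field_simp
  have hdiff : ∀ d : ℕ → ℂ, (Summable fun n => ‖d n‖ * ((ρ : ℝ) ^ 2) ^ n) →
      DifferentiableOn ℂ (fun t => ∑' n, d n * t ^ n) (Metric.ball 0 ((ρ : ℝ) ^ 2)) ∧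
        ∀ t ∈ Metric.ball (0 : ℂ) ((ρ : ℝ) ^ 2), Summable fun n => d n * t ^ n := by
    intro d hd
    have hb : ∀ n, ∀ t ∈ Metric.ball (0 : ℂ) ((ρ : ℝ) ^ 2),
        ‖d n * t ^ n‖ ≤ ‖d n‖ * ((ρ : ℝ) ^ 2) ^ n := by
      intro n t ht
      rw [norm_mul, norm_pow]
      exact mul_le_mul_of_nonneg_left
        (pow_le_pow_left₀ (norm_nonneg _) (mem_ball_zero_iff.1 ht).le n) (norm_nonneg _)
    exact ⟨Complex.differentiableOn_tsum_of_summable_norm hd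
      (fun n => ((differentiable_id.pow n).const_mul _).differentiableOn) Metric.isOpen_ball hb,
      fun t ht => Summable.of_norm_bounded hd fun n => hb n t ht⟩
  have hc0 : ∀ d : ℕ → ℂ, ∑' n, d n * (0 : ℂ) ^ n = d 0 := fun d => by
    rw [tsum_eq_single 0 fun n hn => by simp [hn]]
    simp
  -- The odd part enters with a minus sign, to match the form A - B √.
  refine ⟨ρ, hρ0, fun t => ∑' n, c (2 * n) * t ^ n, fun t => -∑' n, c (2 * n + 1) * t ^ n,
    (hdiff _ hse).1, (hdiff _ hso).1.neg, ?_, ?_, ?_⟩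
  · intro q hq
    have hq2 : q ^ 2 ∈ Metric.ball (0 : ℂ) ((ρ : ℝ) ^ 2) := by
      rw [mem_ball_zero_iff, norm_pow]
      exact pow_lt_pow_left₀ hq (norm_nonneg _) two_ne_zero
    have he := ((hdiff _ hse).2 _ hq2).hasSum
    have ho := (((hdiff _ hso).2 _ hq2).hasSum).mul_right q
    have := HasSum.even_add_odd (f := fun n => c n * q ^ n) (he.congr_fun fun n => by rw [pow_mul])
      (ho.congr_fun fun n => by rw [pow_succ, pow_mul, mul_assoc])
    rw [(hsum q hq).unique this]
    ring
  · refine (hc0 fun n => c (2 * n)).trans ?_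
    simpa [hc0] using (hsum 0 (by simpa using hρ0)).tsum_eq
  · refine congrArg Neg.neg ((hc0 fun n => c (2 * n + 1)).trans ?_)
    rw [hP.hasFPowerSeriesAt.deriv]
    rfl

/-- This is the form in which the principal root of x - g is known to be holomorphic. -/
theorem mem_slitDisc_iff {x r : ℝ} {g : ℂ} :
    g ∈ slitDisc x r ↔ g ∈ Metric.ball (x : ℂ) r ∧ (x : ℂ) - g ∈ Complex.slitPlane := by
  have : Complex.arg (g - x) ≠ 0 ↔ (x : ℂ) - g ∈ Complex.slitPlane := by
    rw [Complex.mem_slitPlane_iff, Ne, Complex.arg_eq_zero_iff]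
    simp only [Complex.sub_re, Complex.sub_im, Complex.ofReal_re, Complex.ofReal_im, zero_sub,
      sub_zero, ne_eq, neg_eq_zero]
    rw [not_and_or, not_le, sub_neg, sub_pos]
  rw [← this, mem_ball_iff_norm]
  rfl

/-- A positive factor does not change the argument, so the principal logarithm is additive here. -/
theorem ofReal_mul_cpow_half {K : ℝ} (hK : 0 < K) {t : ℂ} (ht : t ≠ 0) :
    ((K : ℂ) * t) ^ (1 / 2 : ℂ) = (Real.sqrt K : ℂ) * t ^ (1 / 2 : ℂ) := by
  rw [Real.sqrt_eq_rpow, Complex.ofReal_cpow hK.le,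
    Complex.cpow_def_of_ne_zero (mul_ne_zero (by exact_mod_cast hK.ne') ht),
    Complex.cpow_def_of_ne_zero ht, Complex.cpow_def_of_ne_zero (by exact_mod_cast hK.ne'),
    Complex.log_ofReal_mul hK ht, ← Complex.exp_add, ← Complex.ofReal_log hK.le]
  congr 1
  push_cast
  ring

theorem cpow_half_sq (t : ℂ) : (t ^ (1 / 2 : ℂ)) ^ 2 = t := by
  rw [show (1 / 2 : ℂ) = ((2 : ℕ) : ℂ)⁻¹ by norm_num]
  exact Complex.cpow_nat_inv_pow t two_ne_zero

/-- A function which on the real axis is an analytic function of `√(x - g)` to the left of `x`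
has a square root singularity at `x`. -/
theorem exists_hasSqrtSingularity {Z ψ : ℂ → ℂ} {x z K : ℝ} (hx : 0 < x) (hK : 0 < K)
    (hZ : DifferentiableOn ℂ Z (Metric.ball 0 x)) (hψ : AnalyticAt ℂ ψ 0) (h0 : ψ 0 = z)
    (h1 : deriv ψ 0 = -(Real.sqrt K : ℂ))
    (hev : ∀ᶠ g : ℝ in 𝓝[<] x, Z g = ψ (Real.sqrt (x - g))) :
    ∃ r₀ : ℝ, 0 < r₀ ∧ ∀ r, 0 < r → r ≤ r₀ → HasSqrtSingularity Z x z K r := by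
  obtain ⟨ρ, hρ, A, B, hA, hB, hAB, hA0, hB0⟩ := exists_even_odd_split hψ
  rw [h0] at hA0
  rw [h1, neg_neg] at hB0
  have hnhds : Metric.ball (0 : ℂ) (ρ ^ 2) ∈ 𝓝 0 := Metric.ball_mem_nhds _ (by positivity)
  obtain ⟨CA, hCA0, hCA⟩ := ((hA.differentiableAt hnhds).isBigO_sub).exists_pos
  obtain ⟨CB, hCB0, hCB⟩ := ((hB.differentiableAt hnhds).isBigO_sub).exists_pos
  obtain ⟨r₁, hr₁, hr₁'⟩ := Metric.eventually_nhds_iff_ball.1 (hCA.bound.and hCB.bound)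
  -- The bound ρ² keeps x - g in the domain of A and B, r₁ gives their linear error bounds, and 1
  -- ensures that the root has modulus at most 1.
  refine ⟨min (min (ρ ^ 2) r₁) 1, by positivity, fun r hr hr' => ?_⟩
  have hrρ : r ≤ ρ ^ 2 := hr'.trans ((min_le_left _ _).trans (min_le_left _ _))
  have hrr₁ : r ≤ r₁ := hr'.trans ((min_le_left _ _).trans (min_le_right _ _))
  have hr1 : r ≤ 1 := hr'.trans (min_le_right _ _)
  have hmaps : Set.MapsTo (fun g : ℂ => (x : ℂ) - g) (Metric.ball (x : ℂ) r)
      (Metric.ball (0 : ℂ) (ρ ^ 2)) := fun g hg => by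
    rw [mem_ball_zero_iff, norm_sub_rev]
    exact (mem_ball_iff_norm.1 hg).trans_le hrρ
  have hsub : Differentiable ℂ fun g : ℂ => (x : ℂ) - g := differentiable_id.const_sub _
  have hA' : DifferentiableOn ℂ (fun g => A (x - g)) (Metric.ball (x : ℂ) r) :=
    hA.comp hsub.differentiableOn hmaps
  have hB' : DifferentiableOn ℂ (fun g => B (x - g)) (Metric.ball (x : ℂ) r) :=
    hB.comp hsub.differentiableOn hmaps
  set W : ℂ → ℂ := fun g => A (x - g) - B (x - g) * ((x : ℂ) - g) ^ (1 / 2 : ℂ)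
  have hopen : IsOpen (slitDisc x r) := by
    rw [show slitDisc x r = Metric.ball (x : ℂ) r ∩ (fun g : ℂ => (x : ℂ) - g) ⁻¹'
      Complex.slitPlane from Set.ext fun g => mem_slitDisc_iff]
    exact Metric.isOpen_ball.inter (Complex.isOpen_slitPlane.preimage hsub.continuous)
  have hslit : slitDisc x r ⊆ Metric.ball (x : ℂ) r := fun g hg => (mem_slitDisc_iff.1 hg).1
  have hW : DifferentiableOn ℂ W (slitDisc x r) := by
    refine (hA'.mono hslit).sub ((hB'.mono hslit).mul fun g hg => ?_)
    exact ((hsub g).cpow_const (mem_slitDisc_iff.1 hg).2).differentiableWithinAt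
  have hUs : Metric.ball (0 : ℂ) x ∩ Metric.ball (x : ℂ) r ⊆ slitDisc x r := by
    rintro g ⟨hg1, hg2⟩
    refine mem_slitDisc_iff.2 ⟨hg2, Complex.mem_slitPlane_iff.2 (Or.inl ?_)⟩
    have := (Complex.re_le_norm g).trans_lt (mem_ball_zero_iff.1 hg1)
    simpa using this
  have hUopen : IsOpen (Metric.ball (0 : ℂ) x ∩ Metric.ball (x : ℂ) r) :=
    Metric.isOpen_ball.inter Metric.isOpen_ball
  -- The lens is convex, hence connected, and contains a real interval to the left of x on which Z
  -- and W agree; the identity theorem does the rest.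
  have hZW : Set.EqOn Z W (Metric.ball (0 : ℂ) x ∩ Metric.ball (x : ℂ) r) := by
    obtain ⟨l, hl, hl'⟩ := mem_nhdsLT_iff_exists_Ioo_subset.1 hev
    have hl : l < x := hl
    obtain ⟨t, ht1, ht2⟩ := exists_between (show max l (max 0 (x - r)) < x by
      simp [hl, hx, hr])
    simp only [max_lt_iff] at ht1
    have ht : (t : ℂ) ∈ Metric.ball (0 : ℂ) x ∩ Metric.ball (x : ℂ) r := by
      refine ⟨?_, ?_⟩
      · rw [mem_ball_zero_iff, Complex.norm_real, Real.norm_of_nonneg ht1.2.1.le]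
        exact ht2
      · rw [mem_ball_iff_norm, ← Complex.ofReal_sub, Complex.norm_real, Real.norm_eq_abs, abs_lt]
        constructor <;> linarith
    refine ((hZ.mono Set.inter_subset_left).analyticOnNhd hUopen).eqOn_of_preconnected_of_frequently_eq
      ((hW.mono hUs).analyticOnNhd hUopen)
      ((convex_ball _ _).inter (convex_ball _ _)).isPreconnected ht ?_
    have htend : Filter.Tendsto (fun s : ℝ => (s : ℂ)) (𝓝[≠] t) (𝓝[≠] (t : ℂ)) :=
      tendsto_nhdsWithin_iff.2
        ⟨tendsto_nhdsWithin_of_tendsto_nhds (Complex.continuous_ofReal.tendsto t), by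
          filter_upwards [self_mem_nhdsWithin] with s hs
          simpa using hs⟩
    refine htend.frequently (Filter.Eventually.frequently ?_)
    filter_upwards [nhdsWithin_le_nhds (Ioo_mem_nhds (max_lt ht1.1 ht1.2.2) ht2)] with s hs
    have hs1 := max_lt_iff.1 hs.1
    rw [show Z s = ψ (Real.sqrt (x - s)) from hl' ⟨hs1.1, hs.2⟩]
    have hxs : 0 ≤ x - s := by linarith [hs.2]
    have hroot : ((x : ℂ) - s) ^ (1 / 2 : ℂ) = (Real.sqrt (x - s) : ℂ) := by
      rw [Real.sqrt_eq_rpow, Complex.ofReal_cpow hxs]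
      push_cast
      rfl
    rw [hAB _ ?_]
    · simp only [W, hroot]
      rw [← Complex.ofReal_pow, Real.sq_sqrt hxs, Complex.ofReal_sub]
    · rw [Complex.norm_real, Real.norm_of_nonneg (Real.sqrt_nonneg _), Real.sqrt_lt' hρ]
      linarith [hs1.2]
  classical
  set Y : ℂ → ℂ := fun g => if g ∈ slitDisc x r then W g else Z g with hYdef
  have hYW : ∀ g ∈ slitDisc x r, Y g = W g := fun g hg => if_pos hg
  have hYZ : ∀ g ∈ Metric.ball (0 : ℂ) x, Y g = Z g := by
    intro g hg
    by_cases hgs : g ∈ slitDisc x r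
    · rw [hYW g hgs, hZW ⟨hg, hslit hgs⟩]
    · exact if_neg hgs
  refine ⟨Y, ?_, hYZ, ⟨fun g => A (x - g), fun g => B (x - g), hA', hB', ?_, ?_, hYW⟩,
    CA + CB, ?_⟩
  · rintro g (hg | hg)
    · refine DifferentiableAt.differentiableWithinAt ?_
      have hm := Metric.isOpen_ball.mem_nhds hg
      exact (hZ.differentiableAt hm).congr_of_eventuallyEq (Filter.mem_of_superset hm hYZ)
    · refine DifferentiableAt.differentiableWithinAt ?_
      have hm := hopen.mem_nhds hg
      exact (hW.differentiableAt hm).congr_of_eventuallyEq (Filter.mem_of_superset hm hYW)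
  · simp [hA0]
  · simp [hB0]
  · intro g hg
    have ht0 : (x : ℂ) - g ≠ 0 := Complex.slitPlane_ne_zero (mem_slitDisc_iff.1 hg).2
    have htr : ‖(x : ℂ) - g‖ < r := by
      rw [norm_sub_rev]; exact mem_ball_iff_norm.1 (hslit hg)
    rw [hYW g hg, ofReal_mul_cpow_half hK ht0]
    simp only [W]
    set t := (x : ℂ) - g
    set s := t ^ (1 / 2 : ℂ)
    have hs1 : ‖s‖ ≤ 1 := by
      have : ‖s‖ ^ 2 = ‖t‖ := by rw [← norm_pow, cpow_half_sq]
      nlinarith [norm_nonneg s]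
    obtain ⟨b1, b2⟩ := hr₁' t (mem_ball_zero_iff.2 (htr.trans_le hrr₁))
    rw [hA0, sub_zero] at b1
    rw [hB0, sub_zero] at b2
    calc ‖A t - B t * s - ((z : ℂ) - Real.sqrt K * s)‖
        = ‖(A t - z) - (B t - Real.sqrt K) * s‖ := by congr 1; ring
      _ ≤ ‖A t - z‖ + ‖(B t - Real.sqrt K) * s‖ := norm_sub_le _ _
      _ ≤ CA * ‖t‖ + CB * ‖t‖ := by
        refine add_le_add b1 ?_
        rw [norm_mul]
        exact (mul_le_of_le_one_right (norm_nonneg _) hs1).trans b2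
      _ = (CA + CB) * ‖t‖ := by ring

end SquareRoot

/-! ### Local analysis of the system near the critical point -/

section LocalSolution

theorem _root_.AnalyticAt.exists_eq_add_mul {f : ℂ → ℂ} {c : ℂ} (hf : AnalyticAt ℂ f c) :
    ∃ S : ℂ → ℂ, AnalyticAt ℂ S c ∧ S c = deriv f c ∧ ∀ z, f z = f c + S z * (z - c) := by
  obtain ⟨P, hP⟩ := hf
  refine ⟨dslope f c, hP.has_fpower_series_dslope_fslope.analyticAt, dslope_same f c, fun z => ?_⟩
  have := sub_smul_dslope f c z
  rw [smul_eq_mul] at this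
  linear_combination -this

/-- Dividing out z - c twice by `dslope` gives an identity valid at every z, although R is analytic
only near c. -/
theorem _root_.AnalyticAt.exists_eq_add_mul_add_mul_sq {f : ℂ → ℂ} {c : ℂ}
    (hf : AnalyticAt ℂ f c) :
    ∃ R : ℂ → ℂ, AnalyticAt ℂ R c ∧ R c = deriv (deriv f) c / 2 ∧
      ∀ z, f z = f c + deriv f c * (z - c) + R z * (z - c) ^ 2 := by
  have hP := hf.hasFPowerSeriesAt
  have h2 := hP.has_fpower_series_dslope_fslope.has_fpower_series_dslope_fslope
  refine ⟨dslope (dslope f c) c, h2.analyticAt, ?_, fun z => ?_⟩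
  · set P := FormalMultilinearSeries.ofScalars ℂ fun n => iteratedDeriv n f c / n.factorial with hPdef
    have h4 : P.fslope.fslope.coeff 0 = deriv (deriv f) c / 2 := by
      rw [FormalMultilinearSeries.coeff_fslope, FormalMultilinearSeries.coeff_fslope, hPdef,
        FormalMultilinearSeries.coeff_ofScalars]
      simp [iteratedDeriv_succ, iteratedDeriv_zero, Nat.factorial]
    rw [← h4, ← h2.coeff_zero 1]
    rfl
  · have e1 := sub_smul_dslope f c z
    have e2 := sub_smul_dslope (dslope f c) c z
    rw [dslope_same f c] at e2
    rw [smul_eq_mul] at e1 e2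
    linear_combination -e1 - (z - c) * e2

/-- The analytic implicit function theorem for a scalar function of two complex variables. -/
theorem exists_analytic_implicit {F : ℂ × ℂ → ℂ} {y₀ x₀ d : ℂ} (hF : AnalyticAt ℂ F (y₀, x₀))
    (h0 : F (y₀, x₀) = 0) (hd : HasDerivAt (fun x => F (y₀, x)) d x₀) (hd0 : d ≠ 0) :
    ∃ X : ℂ → ℂ, AnalyticAt ℂ X y₀ ∧ X y₀ = x₀ ∧ (∀ᶠ y in 𝓝 y₀, F (y, X y) = 0) ∧
      ∀ᶠ v : ℂ × ℂ in 𝓝 (y₀, x₀), F v = 0 → v.2 = X v.1 := by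
  -- The order `⊤` of `WithTop ℕ∞` means analytic, so the implicit function comes out analytic as
  -- well.
  have hc : ContDiffAt ℂ ⊤ F (y₀, x₀) := hF.contDiffAt
  have hdir : fderiv ℂ F (y₀, x₀) ∘L .inr ℂ ℂ ℂ =
      (ContinuousLinearEquiv.unitsEquivAut ℂ (Units.mk0 d hd0) : ℂ →L[ℂ] ℂ) := by
    ext
    have h1 : HasDerivAt (fun x : ℂ => (y₀, x)) ((0 : ℂ), (1 : ℂ)) x₀ :=
      (hasDerivAt_const x₀ y₀).prodMk (hasDerivAt_id x₀)
    have h2 := hF.differentiableAt.hasFDerivAt.comp_hasDerivAt x₀ h1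
    simpa using h2.unique hd
  have hinv : (fderiv ℂ F (y₀, x₀) ∘L .inr ℂ ℂ ℂ).IsInvertible := ⟨_, hdir.symm⟩
  have ht : (⊤ : WithTop ℕ∞) ≠ 0 := by simp
  refine ⟨hc.implicitFunction ht hinv, ?_, hc.implicitFunction_apply_self ht hinv, ?_, ?_⟩
  · exact (hc.contDiffAt_implicitFunction ht hinv).analyticAt
  · simpa [h0] using hc.eventually_apply_implicitFunction ht hinv
  · filter_upwards [hc.eventually_apply_eq_iff_implicitFunction ht hinv] with v hv hv0
    exact (hv.1 (hv0.trans h0.symm)).symm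

/-- A square root of an analytic function near a point where its value is positive. -/
theorem exists_analytic_sqrt {k : ℂ → ℂ} {y₀ : ℂ} {c : ℝ} (hk : AnalyticAt ℂ k y₀) (hc : 0 < c)
    (hk0 : k y₀ = c) :
    ∃ κ : ℂ → ℂ, AnalyticAt ℂ κ y₀ ∧ κ y₀ = (Real.sqrt c : ℂ) ∧ (∀ y, κ y ^ 2 = k y) ∧
      ∀ᶠ y in 𝓝 y₀, 0 < (κ y).re := by
  have han : AnalyticAt ℂ (fun y => k y ^ (1 / 2 : ℂ)) y₀ :=
    hk.cpow analyticAt_const (by rw [hk0]; exact Complex.ofReal_mem_slitPlane.2 hc)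
  have hval : k y₀ ^ (1 / 2 : ℂ) = (Real.sqrt c : ℂ) := by
    rw [hk0, Real.sqrt_eq_rpow, Complex.ofReal_cpow hc.le]
    push_cast
    rfl
  refine ⟨_, han, hval, fun y => cpow_half_sq _, ?_⟩
  have hcont : ContinuousAt (fun y => (k y ^ (1 / 2 : ℂ)).re) y₀ :=
    Complex.continuous_re.continuousAt.comp han.continuousAt
  refine hcont.tendsto.eventually (lt_mem_nhds ?_)
  rw [hval]
  simpa using hc

variable {φ : ℂ → ℂ} {a b G x₀ y₀ α : ℂ}

/-- The solution curve of the system near the critical point, with `g` eliminated. -/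
theorem exists_solution_curve (hφx : AnalyticAt ℂ φ x₀) (hφy : AnalyticAt ℂ φ y₀)
    (ex : x₀ = G * (a * φ x₀ + a⁻¹ * φ y₀)) (ey : y₀ = G * (b * φ x₀ + b⁻¹ * φ y₀))
    (hα1 : α * (1 - G * a * deriv φ x₀) = G * a⁻¹ * deriv φ y₀)
    (hα2 : α * (G * b * deriv φ x₀) = 1 - G * b⁻¹ * deriv φ y₀)
    (hD : (b * φ x₀ + b⁻¹ * φ y₀) * (1 - G * a * deriv φ x₀) +
      (a * φ x₀ + a⁻¹ * φ y₀) * (G * b * deriv φ x₀) ≠ 0) :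
    ∃ X : ℂ → ℂ, AnalyticAt ℂ X y₀ ∧ X y₀ = x₀ ∧ deriv X y₀ = α ∧
      ∀ᶠ v : ℂ × ℂ in 𝓝 (y₀, x₀), ∀ g, v.2 = g * (a * φ v.2 + a⁻¹ * φ v.1) →
        v.1 = g * (b * φ v.2 + b⁻¹ * φ v.1) → v.2 = X v.1 := by
  -- Cross-multiplying the two equations eliminates g.
  set F : ℂ × ℂ → ℂ := fun v => v.2 * (b * φ v.2 + b⁻¹ * φ v.1) -
    v.1 * (a * φ v.2 + a⁻¹ * φ v.1)
  have hφ1 : AnalyticAt ℂ (fun v : ℂ × ℂ => φ v.1) (y₀, x₀) :=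
    AnalyticAt.fun_comp (f := Prod.fst) hφy analyticAt_fst
  have hφ2 : AnalyticAt ℂ (fun v : ℂ × ℂ => φ v.2) (y₀, x₀) :=
    AnalyticAt.fun_comp (f := Prod.snd) hφx analyticAt_snd
  have hF : AnalyticAt ℂ F (y₀, x₀) :=
    (analyticAt_snd.mul ((analyticAt_const.mul hφ2).add (analyticAt_const.mul hφ1))).sub
      (analyticAt_fst.mul ((analyticAt_const.mul hφ2).add (analyticAt_const.mul hφ1)))
  have hdx := hφx.differentiableAt.hasDerivAt
  have hdy := hφy.differentiableAt.hasDerivAt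
  have hF0 : F (y₀, x₀) = 0 := by
    simp only [F]
    linear_combination (b * φ x₀ + b⁻¹ * φ y₀) * ex - (a * φ x₀ + a⁻¹ * φ y₀) * ey
  have hFx := ((hasDerivAt_id x₀).mul ((hdx.const_mul b).add_const (b⁻¹ * φ y₀))).sub
    (((hdx.const_mul a).add_const (a⁻¹ * φ y₀)).const_mul y₀)
  -- By the critical equations, ∂F/∂x at the base point is the quantity assumed nonzero in `hD`.
  obtain ⟨X, hX, hX0, hXF, huniq⟩ := exists_analytic_implicit hF hF0 hFx (by
    convert hD using 1
    simp only [id]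
    linear_combination (b * deriv φ x₀) * ex - (a * deriv φ x₀) * ey)
  refine ⟨X, hX, hX0, ?_, ?_⟩
  · have hdX := hX.differentiableAt.hasDerivAt
    have hφX : HasDerivAt (fun y => φ (X y)) (deriv φ x₀ * deriv X y₀) y₀ := by
      rw [← hX0] at hdx
      have := HasDerivAt.comp y₀ hdx hdX
      rwa [hX0] at this
    have hder := (hdX.mul ((hφX.const_mul b).add (hdy.const_mul b⁻¹))).sub
      ((hasDerivAt_id y₀).mul ((hφX.const_mul a).add (hdy.const_mul a⁻¹)))
    have hz := hder.unique ((hasDerivAt_const y₀ (0 : ℂ)).congr_of_eventuallyEq hXF)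
    simp only [hX0, id, Pi.add_apply] at hz
    -- Call that quantity D. Then ∂F/∂x = D, and the two relations for α give ∂F/∂y = -α D, so X' =
    -- α.
    refine mul_right_cancel₀ hD ?_
    linear_combination hz + (-b⁻¹ * deriv φ y₀ - b * deriv φ x₀ * deriv X y₀) * ex +
      (a * deriv φ x₀ * deriv X y₀ + a⁻¹ * deriv φ y₀) * ey -
      (b * φ x₀ + b⁻¹ * φ y₀) * hα1 - (a * φ x₀ + a⁻¹ * φ y₀) * hα2
  · filter_upwards [huniq] with v hv g h1 h2
    refine hv ?_
    simp only [F]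
    linear_combination (b * φ v.2 + b⁻¹ * φ v.1) * h1 - (a * φ v.2 + a⁻¹ * φ v.1) * h2

/-- Near the critical point the solutions of the system are analytic functions of a square root
of `G - g`. -/
theorem exists_local_uniformization {K : ℝ} (hK : 0 < K) (ha : a ≠ 0) (hb : b ≠ 0)
    (hφx : AnalyticAt ℂ φ x₀) (hφy : AnalyticAt ℂ φ y₀)
    (ex : x₀ = G * (a * φ x₀ + a⁻¹ * φ y₀)) (ey : y₀ = G * (b * φ x₀ + b⁻¹ * φ y₀))
    (hα1 : α * (1 - G * a * deriv φ x₀) = G * a⁻¹ * deriv φ y₀)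
    (hα2 : α * (G * b * deriv φ x₀) = 1 - G * b⁻¹ * deriv φ y₀)
    (hD : (b * φ x₀ + b⁻¹ * φ y₀) * (1 - G * a * deriv φ x₀) +
      (a * φ x₀ + a⁻¹ * φ y₀) * (G * b * deriv φ x₀) ≠ 0)
    (hN : α * a * φ x₀ + b⁻¹ * φ y₀ ≠ 0)
    (hk : G * (α ^ 3 * a * deriv (deriv φ) x₀ + b⁻¹ * deriv (deriv φ) y₀) /
      (2 * (α * a * φ x₀ + b⁻¹ * φ y₀)) = (K⁻¹ : ℝ)) :
    ∃ X ψ κ : ℂ → ℂ, AnalyticAt ℂ X y₀ ∧ X y₀ = x₀ ∧ deriv X y₀ = α ∧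
      AnalyticAt ℂ ψ 0 ∧ ψ 0 = y₀ ∧ deriv ψ 0 = -(Real.sqrt K : ℂ) ∧
      ∀ᶠ v : ℂ × ℂ in 𝓝 (y₀, x₀), ∀ g, v.2 = g * (a * φ v.2 + a⁻¹ * φ v.1) →
        v.1 = g * (b * φ v.2 + b⁻¹ * φ v.1) →
        v.2 = X v.1 ∧ v.1 = ψ ((y₀ - v.1) * κ v.1) ∧ ((y₀ - v.1) * κ v.1) ^ 2 = G - g ∧
        0 < (κ v.1).re := by
  obtain ⟨X, hX, hX0, hX', huniq⟩ := exists_solution_curve hφx hφy ex ey hα1 hα2 hD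
  obtain ⟨S, hS, hS0, hSX⟩ := hX.exists_eq_add_mul
  obtain ⟨Rx, hRx, hRx0, hRxφ⟩ := hφx.exists_eq_add_mul_add_mul_sq
  obtain ⟨Ry, hRy, hRy0, hRyφ⟩ := hφy.exists_eq_add_mul_add_mul_sq
  rw [hX'] at hS0
  have hRX : AnalyticAt ℂ (fun y => Rx (X y)) y₀ := by
    rw [← hX0] at hRx
    exact hRx.fun_comp hX
  have hφX : AnalyticAt ℂ (fun y => φ (X y)) y₀ := by
    rw [← hX0] at hφx
    exact hφx.fun_comp hX
  set N : ℂ → ℂ := fun y => α * a * φ (X y) + b⁻¹ * φ y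
  have hNan : AnalyticAt ℂ N y₀ := (analyticAt_const.mul hφX).add (analyticAt_const.mul hφy)
  have hN0 : N y₀ ≠ 0 := by simpa only [N, hX0] using hN
  -- Chosen so that G - g = k(y) (y - y₀)² on the solution curve; Rx and Ry carry the second-order
  -- Taylor terms and S is the slope of X. At y₀ they are φ''/2 and α, whence k(y₀) = 1/K.
  set k : ℂ → ℂ := fun y => G * (α * a * Rx (X y) * S y ^ 2 + b⁻¹ * Ry y) / N y
  have hkan : AnalyticAt ℂ k y₀ := (analyticAt_const.mul
    (((analyticAt_const.mul hRX).mul (hS.pow 2)).add (analyticAt_const.mul hRy))).div hNan hN0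
  have hk0 : k y₀ = (K⁻¹ : ℝ) := by
    rw [← hk]
    simp only [k, N, hX0, hS0, hRx0, hRy0]
    field_simp
  obtain ⟨κ, hκ, hκ0, hκsq, hκre⟩ := exists_analytic_sqrt hkan (inv_pos.2 hK) hk0
  -- A square root of G - g along the curve, with nonzero derivative -1/√K at y₀. The factor y₀ - y
  -- selects the sign that is positive when y approaches y₀ from below.
  set q : ℂ → ℂ := fun y => (y₀ - y) * κ y
  have hq : AnalyticAt ℂ q y₀ := (analyticAt_const.sub analyticAt_id).mul hκ
  have hq0 : q y₀ = 0 := by simp [q]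
  have hsK : Real.sqrt K⁻¹ = (Real.sqrt K)⁻¹ := Real.sqrt_inv K
  have hsK0 : Real.sqrt K ≠ 0 := (Real.sqrt_pos.2 hK).ne'
  have hq' : deriv q y₀ = -((Real.sqrt K : ℂ))⁻¹ := by
    have := ((hasDerivAt_id y₀).const_sub y₀).mul hκ.differentiableAt.hasDerivAt
    have h2 := this.deriv
    simp only [id, sub_self, zero_mul, add_zero, hκ0, hsK] at h2
    refine Eq.trans ?_ (h2.trans ?_)
    · rfl
    · push_cast
      ring
  have hq'0 : deriv q y₀ ≠ 0 := by
    rw [hq']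
    exact neg_ne_zero.2 (inv_ne_zero (by exact_mod_cast hsK0))
  have hstrict := hq.hasStrictDerivAt
  set ψ := hstrict.localInverse q _ y₀ hq'0
  have hψan : AnalyticAt ℂ ψ 0 := by
    have := hq.analyticAt_localInverse hq'0
    rwa [hq0] at this
  have hψq : ∀ᶠ y in 𝓝 y₀, ψ (q y) = y := hstrict.eventually_left_inverse hq'0
  have hψ' : deriv ψ 0 = -(Real.sqrt K : ℂ) := by
    have := (hstrict.to_localInverse hq'0).hasDerivAt.deriv
    rw [hq0] at this
    exact this.trans (by rw [hq', inv_neg, inv_inv])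
  refine ⟨X, ψ, κ, hX, hX0, hX', hψan, by rw [← hq0]; exact hψq.self_of_nhds, hψ', ?_⟩
  have hfst : Filter.Tendsto (Prod.fst : ℂ × ℂ → ℂ) (𝓝 (y₀, x₀)) (𝓝 y₀) :=
    continuous_fst.tendsto (y₀, x₀)
  filter_upwards [huniq, hfst.eventually hψq, hfst.eventually hκre,
    hfst.eventually (hNan.continuousAt.eventually_ne hN0)] with v hv h1 h2 h3 g hg1 hg2
  have hvX := hv g hg1 hg2
  refine ⟨hvX, h1.symm, ?_, h2⟩
  obtain ⟨y, x⟩ := v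
  simp only at hvX hg1 hg2 h3 ⊢
  rw [mul_pow, hκsq]
  simp only [k]
  rw [mul_div_assoc', div_eq_iff h3]
  simp only [N]
  rw [← hvX]
  have hx := hSX y
  rw [← hvX, hX0] at hx
  have e1 := hRxφ x
  have e2 := hRyφ y
  have hdx : Rx x * (x - x₀) ^ 2 = Rx x * S y ^ 2 * (y - y₀) ^ 2 := by rw [hx]; ring
  have haa : a * a⁻¹ = 1 := mul_inv_cancel₀ ha
  have hbb : b * b⁻¹ = 1 := mul_inv_cancel₀ hb
  -- The row (G α a φ'(x₀), G b⁻¹ φ'(y₀)) is the left null vector of 1 - G Φ'; `l1` and `l2` express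
  -- this without the factors φ'(x₀) and φ'(y₀).
  have l1 : α * a = G * α * a * deriv φ x₀ * a + G * b⁻¹ * deriv φ y₀ * b := by
    linear_combination a * hα1 + G * deriv φ y₀ * (haa - hbb)
  have l2 : b⁻¹ = G * α * a * deriv φ x₀ * a⁻¹ + G * b⁻¹ * deriv φ y₀ * b⁻¹ := by
    linear_combination -b⁻¹ * hα2 + G * α * deriv φ x₀ * (hbb - haa)
  -- The combination of the two equations along the left null vector
  have c1 : G * α * a * deriv φ x₀ * x + G * b⁻¹ * deriv φ y₀ * y =
      g * (α * a * φ x + b⁻¹ * φ y) := by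
    linear_combination (G * α * a * deriv φ x₀) * hg1 + (G * b⁻¹ * deriv φ y₀) * hg2 -
      g * φ x * l1 - g * φ y * l2
  have c2 : G * α * a * deriv φ x₀ * x₀ + G * b⁻¹ * deriv φ y₀ * y₀ =
      G * (α * a * φ x₀ + b⁻¹ * φ y₀) := by
    linear_combination (G * α * a * deriv φ x₀) * ex + (G * b⁻¹ * deriv φ y₀) * ey -
      G * φ x₀ * l1 - G * φ y₀ * l2
  -- On subtracting `c2` from `c1` the first-order Taylor terms cancel, and (G - g) N equals the
  -- quadratic remainder.
  linear_combination -G * α * a * hdx - c1 + c2 - G * α * a * e1 - G * b⁻¹ * e2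

end LocalSolution

/-! ### Application to the generating functions at g₀ -/

section Main

variable {p : ℕ → ℝ} {β h : ℝ}

theorem deriv_phiC_ofReal {c : ℕ → ℝ} (hc : ∀ n, 0 ≤ c n) {x : ℝ} (hx : 0 ≤ x)
    (h : ENNReal.ofReal x < convRadius c) : deriv (phiC c) x = (phi (derivCoeff c) x : ℂ) := by
  rw [(hasDerivAt_phiC hc (by rwa [Complex.norm_real, Real.norm_of_nonneg hx])).deriv, phiC_ofReal]

theorem deriv_deriv_phiC_ofReal {c : ℕ → ℝ} (hc : ∀ n, 0 ≤ c n) {x : ℝ} (hx : 0 ≤ x)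
    (h : ENNReal.ofReal x < convRadius c) :
    deriv (deriv (phiC c)) x = (phi (derivCoeff (derivCoeff c)) x : ℂ) := by
  obtain ⟨y, hxy, hy0, hy⟩ := exists_gt_of_lt_convRadius h
  have : deriv (phiC c) =ᶠ[𝓝 (x : ℂ)] phiC (derivCoeff c) := by
    have hm : Metric.ball (0 : ℂ) y ∈ 𝓝 (x : ℂ) := Metric.isOpen_ball.mem_nhds (by
      rwa [mem_ball_zero_iff, Complex.norm_real, Real.norm_of_nonneg hx])
    filter_upwards [hm] with w hw
    exact (hasDerivAt_phiC hc ((ENNReal.ofReal_le_ofReal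
      (mem_ball_zero_iff.1 hw).le).trans_lt hy)).deriv
  rw [this.deriv_eq]
  exact deriv_phiC_ofReal (derivCoeff_nonneg hc) hx (h.trans_le (convRadius_le_derivCoeff hc))

theorem differentiableOn_genFn (hp : ∀ n, 0 ≤ p n) (h1 : critRadius p β h < ⊤) (ε : ℤˣ) :
    DifferentiableOn ℂ (genFn p β h ε) (Metric.ball 0 (g0 p β h)) :=
  differentiableOn_phiC (partitionFn_nonneg hp β h ε)
    (by rw [convRadius_partitionFn hp, ofReal_g0 h1])

variable (hp : ∀ n, 0 ≤ p n) (hp0 : p 0 ≠ 0) (hp2 : ∃ n, 2 ≤ n ∧ p n ≠ 0)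
  (h0 : 0 < critRadius p β h) (h1 : critRadius p β h < ⊤) (hgen : IsGeneric p β h)

include hp hp0 hp2 h0 h1 hgen

theorem deriv_phi_Z0_pos (ε : ℤˣ) : 0 < deriv (phi p) (Z0 p β h ε) := by
  obtain ⟨n, hn⟩ := (exists_derivCoeff_ne_zero hp2).1
  rw [deriv_phi hp (Z0_nonneg p β h ε) (hgen.Z0_lt ε)]
  exact phi_pos (derivCoeff_nonneg hp) (Z0_pos hp h0 h1 hgen hp0 ε)
    ((hgen.Z0_lt ε).trans_le (convRadius_le_derivCoeff hp)) hn

theorem deriv_deriv_phi_Z0_pos (ε : ℤˣ) : 0 < deriv (deriv (phi p)) (Z0 p β h ε) := by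
  obtain ⟨n, hn⟩ := (exists_derivCoeff_ne_zero hp2).2
  rw [deriv_deriv_phi hp (Z0_pos hp h0 h1 hgen hp0 ε) (hgen.Z0_lt ε)]
  exact phi_pos (derivCoeff_nonneg (derivCoeff_nonneg hp)) (Z0_pos hp h0 h1 hgen hp0 ε)
    (((hgen.Z0_lt ε).trans_le (convRadius_le_derivCoeff hp)).trans_le
      (convRadius_le_derivCoeff (derivCoeff_nonneg hp))) hn

/-- The diagonal entries of `g₀ Φ'` are less than one, and `1 - g₀ Φ'` is singular. -/
theorem critical_matrix :
    0 < 1 - g0 p β h * a β h * deriv (phi p) (Z0 p β h 1) ∧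
    0 < 1 - g0 p β h * (b β h)⁻¹ * deriv (phi p) (Z0 p β h (-1)) ∧
    (1 - g0 p β h * a β h * deriv (phi p) (Z0 p β h 1)) *
        (1 - g0 p β h * (b β h)⁻¹ * deriv (phi p) (Z0 p β h (-1))) -
      g0 p β h * (a β h)⁻¹ * deriv (phi p) (Z0 p β h (-1)) *
        (g0 p β h * b β h * deriv (phi p) (Z0 p β h 1)) = 0 := by
  have dx := deriv_phi_Z0_pos hp hp0 hp2 h0 h1 hgen 1
  have dy := deriv_phi_Z0_pos hp hp0 hp2 h0 h1 hgen (-1)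
  obtain ⟨l1, l2, -⟩ := critical_le hp h0 h1 hgen hp0
  have hdet := det_eq_zero hp h0 h1 hgen hp0
  rw [← deriv_phi hp (Z0_nonneg p β h 1) (hgen.Z0_lt 1)] at l1 hdet
  rw [← deriv_phi hp (Z0_nonneg p β h (-1)) (hgen.Z0_lt (-1))] at l2 hdet
  have ha := a_pos β h
  have hb := b_pos β h
  have hg := g0_pos h0 h1
  -- Since φ' > 0 at the critical values, the off-diagonal product is positive. The vanishing
  -- determinant transfers this to the diagonal product, so neither weakly positive factor is zero.
  have hprod : 0 < (1 - g0 p β h * a β h * deriv (phi p) (Z0 p β h 1)) *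
        (1 - g0 p β h * (b β h)⁻¹ * deriv (phi p) (Z0 p β h (-1))) := by
    rw [sub_eq_zero.1 hdet]
    positivity
  exact ⟨pos_of_mul_pos_left hprod (by linarith), pos_of_mul_pos_right hprod (by linarith), hdet⟩

theorem alpha_pos : 0 < alpha p β h := by
  have dy := deriv_phi_Z0_pos hp hp0 hp2 h0 h1 hgen (-1)
  exact div_pos (mul_pos (mul_pos (g0_pos h0 h1) (inv_pos.2 (a_pos β h))) dy)
    (critical_matrix hp hp0 hp2 h0 h1 hgen).1

theorem alpha_mul_one_sub : alpha p β h * (1 - g0 p β h * a β h * deriv (phi p) (Z0 p β h 1)) =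
    g0 p β h * (a β h)⁻¹ * deriv (phi p) (Z0 p β h (-1)) :=
  div_mul_cancel₀ _ (critical_matrix hp hp0 hp2 h0 h1 hgen).1.ne'

/-- With a singular matrix, both rows of (1 - g₀ Φ') (α, 1) = 0 hold once the first does. -/
theorem alpha_mul : alpha p β h * (g0 p β h * b β h * deriv (phi p) (Z0 p β h 1)) =
    1 - g0 p β h * (b β h)⁻¹ * deriv (phi p) (Z0 p β h (-1)) := by
  obtain ⟨l1, -, hdet⟩ := critical_matrix hp hp0 hp2 h0 h1 hgen
  refine mul_right_cancel₀ l1.ne' ?_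
  linear_combination (g0 p β h * b β h * deriv (phi p) (Z0 p β h 1)) *
    alpha_mul_one_sub hp hp0 hp2 h0 h1 hgen - hdet

omit hp2 in
theorem phi_Z0_pos (ε : ℤˣ) : 0 < phi p (Z0 p β h ε) :=
  phi_pos hp (Z0_pos hp h0 h1 hgen hp0 ε) (hgen.Z0_lt ε) hp0

theorem Kminus_pos : 0 < Kminus p β h := by
  have hα := alpha_pos hp hp0 hp2 h0 h1 hgen
  have f := phi_Z0_pos hp hp0 h0 h1 hgen
  have d := deriv_deriv_phi_Z0_pos hp hp0 hp2 h0 h1 hgen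
  have f1 := f 1
  have f2 := f (-1)
  have d1 := d 1
  have d2 := d (-1)
  have ha := a_pos β h
  have hb := b_pos β h
  have hg := g0_pos h0 h1
  rw [Kminus]
  positivity

/-- Both generating functions are, to the left of `g₀` on the real axis, analytic functions of
`√(g₀ - g)`. -/
theorem exists_uniformization : ∃ X ψ : ℂ → ℂ,
    AnalyticAt ℂ X (Z0 p β h (-1)) ∧ X (Z0 p β h (-1)) = Z0 p β h 1 ∧
    deriv X (Z0 p β h (-1)) = alpha p β h ∧
    AnalyticAt ℂ ψ 0 ∧ ψ 0 = Z0 p β h (-1) ∧ deriv ψ 0 = -(Real.sqrt (Kminus p β h) : ℂ) ∧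
    ∀ᶠ g : ℝ in 𝓝[<] g0 p β h,
      genFn p β h 1 g = X (ψ (Real.sqrt (g0 p β h - g))) ∧
      genFn p β h (-1) g = ψ (Real.sqrt (g0 p β h - g)) := by
  have hα := alpha_pos hp hp0 hp2 h0 h1 hgen
  have hα1 := alpha_mul_one_sub hp hp0 hp2 h0 h1 hgen
  have hα2 := alpha_mul hp hp0 hp2 h0 h1 hgen
  have f1 := phi_Z0_pos hp hp0 h0 h1 hgen 1
  have f2 := phi_Z0_pos hp hp0 h0 h1 hgen (-1)
  have dx := deriv_phi_Z0_pos hp hp0 hp2 h0 h1 hgen 1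
  have d1 := deriv_deriv_phi_Z0_pos hp hp0 hp2 h0 h1 hgen 1
  have d2 := deriv_deriv_phi_Z0_pos hp hp0 hp2 h0 h1 hgen (-1)
  have l1 := (critical_matrix hp hp0 hp2 h0 h1 hgen).1
  have ha := a_pos β h
  have hb := b_pos β h
  have hg := g0_pos h0 h1
  have hnorm : ∀ ε, ENNReal.ofReal ‖(Z0 p β h ε : ℂ)‖ < convRadius p := fun ε => by
    rw [Complex.norm_real, Real.norm_of_nonneg (Z0_nonneg p β h ε)]
    exact hgen.Z0_lt ε
  have hd : ∀ ε, deriv (phiC p) (Z0 p β h ε) = ((deriv (phi p) (Z0 p β h ε) : ℝ) : ℂ) := fun ε => by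
    rw [deriv_phiC_ofReal hp (Z0_nonneg p β h ε) (hgen.Z0_lt ε),
      deriv_phi hp (Z0_nonneg p β h ε) (hgen.Z0_lt ε)]
  have hdd : ∀ ε, deriv (deriv (phiC p)) (Z0 p β h ε) =
      ((deriv (deriv (phi p)) (Z0 p β h ε) : ℝ) : ℂ) := fun ε => by
    rw [deriv_deriv_phiC_ofReal hp (Z0_nonneg p β h ε) (hgen.Z0_lt ε),
      deriv_deriv_phi hp (Z0_pos hp h0 h1 hgen hp0 ε) (hgen.Z0_lt ε)]
  have hD : 0 < (b β h * phi p (Z0 p β h 1) + (b β h)⁻¹ * phi p (Z0 p β h (-1))) *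
      (1 - g0 p β h * a β h * deriv (phi p) (Z0 p β h 1)) +
      (a β h * phi p (Z0 p β h 1) + (a β h)⁻¹ * phi p (Z0 p β h (-1))) *
      (g0 p β h * b β h * deriv (phi p) (Z0 p β h 1)) := by positivity
  have hN : 0 < alpha p β h * a β h * phi p (Z0 p β h 1) +
      (b β h)⁻¹ * phi p (Z0 p β h (-1)) := by positivity
  have hden : 0 < alpha p β h ^ 3 * a β h * deriv (deriv (phi p)) (Z0 p β h 1) +
        (b β h)⁻¹ * deriv (deriv (phi p)) (Z0 p β h (-1)) := by positivity
  have hk : g0 p β h * (alpha p β h ^ 3 * a β h * deriv (deriv (phi p)) (Z0 p β h 1) +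
        (b β h)⁻¹ * deriv (deriv (phi p)) (Z0 p β h (-1))) /
      (2 * (alpha p β h * a β h * phi p (Z0 p β h 1) +
      (b β h)⁻¹ * phi p (Z0 p β h (-1)))) = (Kminus p β h)⁻¹ := by
    rw [Kminus, div_mul_div_comm, inv_div]
  obtain ⟨X, ψ, κ, hX, hX0, hX', hψ, hψ0, hψ', hev⟩ :=
    exists_local_uniformization (φ := phiC p) (a := a β h) (b := b β h) (G := g0 p β h)
      (x₀ := Z0 p β h 1) (y₀ := Z0 p β h (-1)) (α := alpha p β h)
      (Kminus_pos hp hp0 hp2 h0 h1 hgen) (by exact_mod_cast ha.ne') (by exact_mod_cast hb.ne')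
      (analyticAt_phiC hp (hnorm 1)) (analyticAt_phiC hp (hnorm (-1)))
      (by rw [phiC_ofReal, phiC_ofReal]; exact_mod_cast Z0_one_eq hp h0 h1 hgen)
      (by rw [phiC_ofReal, phiC_ofReal]; exact_mod_cast Z0_neg_eq hp h0 h1 hgen)
      (by rw [hd, hd]; exact_mod_cast hα1)
      (by rw [hd, hd]; exact_mod_cast hα2)
      (by rw [hd, phiC_ofReal, phiC_ofReal]; exact_mod_cast hD.ne')
      (by rw [phiC_ofReal, phiC_ofReal]; exact_mod_cast hN.ne')
      (by rw [hdd, hdd, phiC_ofReal, phiC_ofReal]; exact_mod_cast hk)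
  refine ⟨X, ψ, hX, hX0, hX', hψ, hψ0, hψ', ?_⟩
  have hlim : ∀ ε, Filter.Tendsto (fun g : ℝ => (genFnReal p β h ε g : ℂ)) (𝓝[<] g0 p β h)
      (𝓝 (Z0 p β h ε : ℂ)) := fun ε =>
    (Complex.continuous_ofReal.tendsto _).comp (tendsto_genFnReal hp h0 h1 hgen ε)
  have hlim2 := (hlim (-1)).prodMk_nhds (hlim 1)
  filter_upwards [hlim2.eventually hev, Ioo_mem_nhdsLT hg] with g hgv hgI
  obtain ⟨k1, k2, k3, k4⟩ := hgv g
    (by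
      simp only [phiC_ofReal]
      exact_mod_cast genFnReal_one_eq hp h0 h1 hgen hgI.1.le hgI.2.le)
    (by
      simp only [phiC_ofReal]
      exact_mod_cast genFnReal_neg_eq hp h0 h1 hgen hgI.1.le hgI.2.le)
  have hpos : 0 < g0 p β h - g := sub_pos.2 hgI.2
  have hle := genFnReal_le hp h0 h1 hgen hgI.1.le hgI.2.le (-1)
  set y := genFnReal p β h (-1) g
  -- Only the square of this quantity is known. Since Z_-(g) ≤ Z_-⁰ and κ has positive real part,
  -- its real part is nonnegative, which excludes the root -√(g₀ - g).
  have hre : 0 ≤ (((Z0 p β h (-1) : ℂ) - y) * κ y).re := by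
    rw [← Complex.ofReal_sub, Complex.re_ofReal_mul]
    exact mul_nonneg (sub_nonneg.2 hle) k4.le
  have hroot : ((Z0 p β h (-1) : ℂ) - y) * κ y = (Real.sqrt (g0 p β h - g) : ℂ) := by
    have hsq : (((Z0 p β h (-1) : ℂ) - y) * κ y) ^ 2 = (Real.sqrt (g0 p β h - g) : ℂ) ^ 2 := by
      rw [k3, ← Complex.ofReal_pow, Real.sq_sqrt hpos.le, Complex.ofReal_sub]
    rcases sq_eq_sq_iff_eq_or_eq_neg.1 hsq with e | e
    · exact e
    · rw [e, Complex.neg_re, Complex.ofReal_re] at hre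
      linarith [Real.sqrt_pos.2 hpos]
  rw [hroot] at k2
  rw [genFn_ofReal, genFn_ofReal, ← k2]
  exact ⟨k1, rfl⟩

theorem sqrt_Kplus : Real.sqrt (Kplus p β h) = alpha p β h * Real.sqrt (Kminus p β h) := by
  have hα := alpha_pos hp hp0 hp2 h0 h1 hgen
  rw [Kplus, Real.sqrt_mul (sq_nonneg _), Real.sqrt_sq hα.le]

theorem exists_hasSqrtSingularity_genFn : ∃ r : ℝ, 0 < r ∧
    HasSqrtSingularity (genFn p β h 1) (g0 p β h) (Z0 p β h 1) (Kplus p β h) r ∧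
    HasSqrtSingularity (genFn p β h (-1)) (g0 p β h) (Z0 p β h (-1)) (Kminus p β h) r := by
  obtain ⟨X, ψ, hX, hX0, hX', hψ, hψ0, hψ', hev⟩ :=
    exists_uniformization hp hp0 hp2 h0 h1 hgen
  have hK := Kminus_pos hp hp0 hp2 h0 h1 hgen
  have hK' : 0 < Kplus p β h := mul_pos (pow_pos (alpha_pos hp hp0 hp2 h0 h1 hgen) 2) hK
  have hg := g0_pos h0 h1
  rw [← hψ0] at hX
  -- By the chain rule the coefficient for Z_+ is α √K_-, which is √K_+ because α > 0.
  have hcomp : deriv (fun q => X (ψ q)) 0 = -(Real.sqrt (Kplus p β h) : ℂ) := by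
    have := (hX.differentiableAt.hasDerivAt.comp (0 : ℂ) hψ.differentiableAt.hasDerivAt).deriv
    rw [hψ0, hX', hψ'] at this
    rw [sqrt_Kplus hp hp0 hp2 h0 h1 hgen]
    refine this.trans ?_
    push_cast
    ring
  obtain ⟨r₁, hr₁, H₁⟩ := exists_hasSqrtSingularity hg hK' (differentiableOn_genFn hp h1 1)
    (hX.fun_comp hψ) (by rw [hψ0, hX0]) hcomp (hev.mono fun g hg => hg.1)
  obtain ⟨r₂, hr₂, H₂⟩ := exists_hasSqrtSingularity hg hK (differentiableOn_genFn hp h1 (-1))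
    hψ hψ0 hψ' (hev.mono fun g hg => hg.2)
  have hr : 0 < min r₁ r₂ := lt_min hr₁ hr₂
  exact ⟨min r₁ r₂, hr, H₁ _ hr (min_le_left _ _), H₂ _ hr (min_le_right _ _)⟩

end Main

end IsingTree

end

theorem mainTheorem9 (p : ℕ → ℝ) (hp : ∀ n, 0 ≤ p n) (hp0 : p 0 ≠ 0)
    (hp2 : ∃ n, 2 ≤ n ∧ p n ≠ 0) (hξ : 0 < IsingTree.convRadius p) (β h : ℝ)
    (hgen : IsingTree.IsGeneric p β h) :
    (0 < IsingTree.critRadius p β h ∧ IsingTree.critRadius p β h < ⊤ ∧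
      IsingTree.convRadius (IsingTree.partitionFn p β h (-1)) = IsingTree.critRadius p β h) ∧
    IsingTree.IsCriticalSolution p β h
      (IsingTree.Z0 p β h 1) (IsingTree.Z0 p β h (-1)) (IsingTree.g0 p β h) ∧
    (0 < IsingTree.alpha p β h ∧
      IsingTree.alpha p β h =
        (1 - IsingTree.g0 p β h * (IsingTree.b β h)⁻¹ *
            deriv (IsingTree.phi p) (IsingTree.Z0 p β h (-1))) /
          (IsingTree.g0 p β h * IsingTree.b β h *
            deriv (IsingTree.phi p) (IsingTree.Z0 p β h 1))) ∧
    0 < IsingTree.Kminus p β h ∧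
    ∃ r : ℝ, 0 < r ∧
      IsingTree.HasSqrtSingularity (IsingTree.genFn p β h 1) (IsingTree.g0 p β h)
        (IsingTree.Z0 p β h 1) (IsingTree.Kplus p β h) r ∧
      IsingTree.HasSqrtSingularity (IsingTree.genFn p β h (-1)) (IsingTree.g0 p β h)
        (IsingTree.Z0 p β h (-1)) (IsingTree.Kminus p β h) r := by
  have h0 := IsingTree.critRadius_pos (β := β) (h := h) hp hξ
  have h1 := IsingTree.critRadius_lt_top (β := β) (h := h) hp hp0 hp2
  refine ⟨⟨h0, h1, IsingTree.convRadius_partitionFn hp (-1)⟩,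
    ⟨IsingTree.Z0_one_eq hp h0 h1 hgen, IsingTree.Z0_neg_eq hp h0 h1 hgen, ?_⟩,
    ⟨IsingTree.alpha_pos hp hp0 hp2 h0 h1 hgen, ?_⟩,
    IsingTree.Kminus_pos hp hp0 hp2 h0 h1 hgen,
    IsingTree.exists_hasSqrtSingularity_genFn hp hp0 hp2 h0 h1 hgen⟩
  · rw [IsingTree.det_one_sub_smul_PhiPrime]
    exact (IsingTree.critical_matrix hp hp0 hp2 h0 h1 hgen).2.2
  · rw [eq_div_iff]
    · exact IsingTree.alpha_mul hp hp0 hp2 h0 h1 hgen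
    · exact (mul_pos (mul_pos (IsingTree.g0_pos h0 h1) (IsingTree.b_pos β h))
        (IsingTree.deriv_phi_Z0_pos hp hp0 hp2 h0 h1 hgen 1)).ne'
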